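/- Let $N\ge 2$, $s\in(0,1)$ and $m>0$, and let $g:\mathbb R\to\mathbb R$ satisfy, with $G(t)=\int_0^t g(\tau)\,d\tau$, (g1) $g$ is continuous and $\lim_{t\to0} g(t)/t=0$; (g2) $\lim_{|t|\to\infty} g(t)/|t|^{p}=0$, where $p=1+\frac{4s}{N}$; (g3) there exists $t_0>0$ with $G(t_0)>0$. Let $H^s_r(\mathbb R^N)$ be the space of real-valued radial functions in $H^s(\mathbb R^N)$, with the norm $\|u\|^2=\|u\|_2^2+\|(-\Delta)^{s/2}u\|_2^2$, and for $(\lambda,u)\in\mathbb R\times H^s_r(\mathbb R^N)$ put $$\mathcal I(\lambda,u)=\frac12\int_{\mathbb R^N}|(-\Delta)^{s/2}u|^2\,dx-\int_{\mathbb R^N}G(u)\,dx+\frac{e^\lambda}{2}\big(\|u\|_2^2-m\big),$$ $$\mathcal P(\lambda,u)=\frac{N-2s}{2}\int_{\mathbb R^N}|(-\Delta)^{s/2}u|^2\,dx+N\int_{\mathbb R^N}\Big(\frac{e^\lambda}{2}u^2-G(u)\Big)dx .$$ Then $G(u)\in L^1(\mathbb R^N)$ for every $u\in H^s_r(\mathbb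 R^N)$, and $\mathcal I$ is of class $C^1$ on $\mathbb R\times H^s_r(\mathbb R^N)$. Moreover, for every $b<0$, $\mathcal I$ satisfies the Palais–Smale–Pohozaev condition at level $b$: every sequence $(\lambda_n,u_n)$ in $\mathbb R\times H^s_r(\mathbb R^N)$ such that $$\mathcal I(\lambda_n,u_n)\to b,\quad \partial_\lambda\mathcal I(\lambda_n,u_n)\to0,\quad \|\partial_u\mathcal I(\lambda_n,u_n)\|_{(H^s_r(\mathbb R^N))^*}\to0,\quad \mathcal P(\lambda_n,u_n)\to0$$ has a subsequence that converges strongly in $\mathbb R\times H^s_r(\mathbb R^N)$. In particular, the set $$K_b^{PSP}=\{(\lambda,u)\in\mathbb R\times H^s_r(\mathbb R^N) : \mathcal I(\lambda,u)=b,\ \partial_\lambda\mathcal I(\lambda,u)=0,\ \partial_u\mathcal I(\lambda,u)=0,\ \mathcal P(\lambda,u)=0\}$$ is compact and $K_b^{PSP}\cap(\mathbb R\times\{0\})=\emptyset$. -/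

import Mathlib

open MeasureTheory Filter Topology Set
open scoped FourierTransform ENNReal

noncomputable section

namespace FracNLS

/-- The Euclidean space `ℝ^N`. -/
abbrev Space (N : ℕ) : Type := EuclideanSpace ℝ (Fin N)

/-- The real Hilbert space `L²(ℝ^N)` of real valued functions. -/
abbrev L2R (N : ℕ) : Type := Lp ℝ 2 (volume : Measure (Space N))

/-- The space `L²(ℝ^N; ℂ)` of complex valued functions. -/
abbrev L2C (N : ℕ) : Type := Lp ℂ 2 (volume : Measure (Space N))

/-- A real valued `L²` function regarded as a complex valued one. -/
def complexify (N : ℕ) : L2R N →L[ℝ] L2C N :=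
  Complex.ofRealCLM.compLpL 2 volume

/-- The Fourier transform of a real valued `L²` function. Mathlib's kernel is
`exp (-2 π i ⟪x, ξ⟫)`, so that Plancherel's identity holds without a constant. -/
def fourierL2 (N : ℕ) (u : L2R N) : L2C N := 𝓕 (complexify N u)

/-- The function `ξ ↦ |ξ|^s 𝓕 u (ξ)`. With the kernel `exp (-2 π i ⟪x, ξ⟫)` the symbol of `-Δ` is
`(2 π |ξ|)²`, so that the symbol of `(-Δ)^(s/2)` is `(2 π |ξ|)^s`. -/
def fracSymbol (N : ℕ) (s : ℝ) (u : L2R N) (ξ : Space N) : ℂ :=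
  (((2 * Real.pi * ‖ξ‖) ^ s : ℝ) : ℂ) * fourierL2 N u ξ

lemma fourierL2_add (N : ℕ) (u v : L2R N) :
    fourierL2 N (u + v) = fourierL2 N u + fourierL2 N v := by
  simp only [fourierL2, map_add]
  exact (Lp.fourierTransformₗᵢ (Space N) ℂ).map_add _ _

lemma fourierL2_smul (N : ℕ) (c : ℝ) (u : L2R N) :
    fourierL2 N (c • u) = c • fourierL2 N u := by
  simp only [fourierL2, map_smul]
  have h : ∀ w : L2C N, c • w = (c : ℂ) • w := fun w => (Complex.coe_smul c w).symm
  rw [h, h]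
  exact (Lp.fourierTransformₗᵢ (Space N) ℂ).map_smul _ _

lemma fracSymbol_add (N : ℕ) (s : ℝ) (u v : L2R N) :
    fracSymbol N s (u + v) =ᵐ[volume] fracSymbol N s u + fracSymbol N s v := by
  filter_upwards [Lp.coeFn_add (fourierL2 N u) (fourierL2 N v)] with ξ h
  simp only [fracSymbol, fourierL2_add, Pi.add_apply, h]
  ring

lemma fracSymbol_smul (N : ℕ) (s c : ℝ) (u : L2R N) :
    fracSymbol N s (c • u) =ᵐ[volume] c • fracSymbol N s u := by
  filter_upwards [Lp.coeFn_smul c (fourierL2 N u)] with ξ h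
  simp only [fracSymbol, fourierL2_smul, Pi.smul_apply, h, Complex.real_smul]
  ring

lemma fracSymbol_zero (N : ℕ) (s : ℝ) : fracSymbol N s 0 =ᵐ[volume] 0 := by
  have h := fracSymbol_smul N s 0 0
  simpa using h

/-- The fractional Sobolev space `H^s(ℝ^N)` of real valued functions, as a set of `L²` functions:
`u ∈ L²` belongs to it if `∫ |ξ|^(2s) |𝓕 u|² dξ < ∞`. -/
def sobolev (N : ℕ) (s : ℝ) : Submodule ℝ (L2R N) where
  carrier := {u | MemLp (fracSymbol N s u) 2 volume}
  add_mem' := fun {u v} hu hv => (memLp_congr_ae (fracSymbol_add N s u v)).2 (hu.add hv)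
  zero_mem' := (memLp_congr_ae (fracSymbol_zero N s)).2 MemLp.zero'
  smul_mem' := fun c u hu => (memLp_congr_ae (fracSymbol_smul N s c u)).2 (hu.const_smul c)

/-- The radial `L²` functions: `u(x)` depends only on `|x|`, up to a null set. -/
def radial (N : ℕ) : Submodule ℝ (L2R N) where
  carrier := {u | ∃ f : ℝ → ℝ, ∀ᵐ x : Space N, u x = f ‖x‖}
  add_mem' := by
    rintro u v ⟨f, hf⟩ ⟨k, hk⟩
    refine ⟨fun r => f r + k r, ?_⟩
    filter_upwards [hf, hk, Lp.coeFn_add u v] with x h1 h2 h3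
    change (u + v : L2R N) x = _
    rw [h3, Pi.add_apply, h1, h2]
  zero_mem' := by
    refine ⟨fun _ => 0, ?_⟩
    filter_upwards [Lp.coeFn_zero ℝ 2 (volume : Measure (Space N))] with x h
    exact h
  smul_mem' := by
    rintro c u ⟨f, hf⟩
    refine ⟨fun r => c * f r, ?_⟩
    filter_upwards [hf, Lp.coeFn_smul c u] with x h1 h2
    change (c • u : L2R N) x = _
    rw [h2, Pi.smul_apply, h1, smul_eq_mul]

/-- The space `H^s_r(ℝ^N)` of radial functions in `H^s(ℝ^N)`. This is a type of its own since it
carries the `H^s` norm and not the `L²` norm. -/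
def RadialSobolev (N : ℕ) (s : ℝ) : Type := ↥(sobolev N s ⊓ radial N)

namespace RadialSobolev

variable {N : ℕ} {s : ℝ}

instance : AddCommGroup (RadialSobolev N s) :=
  inferInstanceAs (AddCommGroup ↥(sobolev N s ⊓ radial N))

instance : Module ℝ (RadialSobolev N s) :=
  inferInstanceAs (Module ℝ ↥(sobolev N s ⊓ radial N))

/-- The underlying `L²` function. -/
def toL2 : RadialSobolev N s →ₗ[ℝ] L2R N := (sobolev N s ⊓ radial N).subtype

lemma memLp_fracSymbol (u : RadialSobolev N s) : MemLp (fracSymbol N s (toL2 u)) 2 volume :=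
  u.2.1

/-- The function `(-Δ)^(s/2) u = 𝓕⁻¹ (|ξ|^s 𝓕 u)`, an element of `L²`. -/
def fracLap (u : RadialSobolev N s) : L2C N := 𝓕⁻ (memLp_fracSymbol u).toLp

lemma fracLap_add (u v : RadialSobolev N s) : fracLap (u + v) = fracLap u + fracLap v := by
  have h : (memLp_fracSymbol (u + v)).toLp =
      (memLp_fracSymbol u).toLp + (memLp_fracSymbol v).toLp := by
    rw [← MemLp.toLp_add, MemLp.toLp_eq_toLp_iff, map_add]
    exact fracSymbol_add N s _ _
  simp only [fracLap, h]
  exact (Lp.fourierTransformₗᵢ (Space N) ℂ).symm.map_add _ _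

lemma fracLap_smul (c : ℝ) (u : RadialSobolev N s) : fracLap (c • u) = c • fracLap u := by
  have h : (memLp_fracSymbol (c • u)).toLp = (c : ℂ) • (memLp_fracSymbol u).toLp := by
    rw [← MemLp.toLp_const_smul, MemLp.toLp_eq_toLp_iff, map_smul]
    exact fracSymbol_smul N s c _
  have h' : ∀ w : L2C N, c • w = (c : ℂ) • w := fun w => (Complex.coe_smul c w).symm
  simp only [fracLap, h, h']
  exact (Lp.fourierTransformₗᵢ (Space N) ℂ).symm.map_smul _ _

/-- The map `u ↦ (u, (-Δ)^(s/2) u)` into the Hilbert sum `L² ⊕ L²`. -/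
def graphMap (N : ℕ) (s : ℝ) : RadialSobolev N s →ₗ[ℝ] WithLp 2 (L2R N × L2C N) where
  toFun u := WithLp.toLp 2 (toL2 u, fracLap u)
  map_add' u v := by rw [map_add, fracLap_add]; rfl
  map_smul' c u := by rw [map_smul, fracLap_smul]; rfl

lemma graphMap_injective (N : ℕ) (s : ℝ) : Function.Injective (graphMap N s) := by
  intro u v h
  have h1 : toL2 u = toL2 v := congrArg (fun w => (WithLp.ofLp w).1) h
  exact Subtype.ext h1

/-- The `H^s` norm, `‖u‖² = ‖u‖₂² + ‖(-Δ)^(s/2) u‖₂²`. -/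
instance : NormedAddCommGroup (RadialSobolev N s) :=
  NormedAddCommGroup.induced (RadialSobolev N s) (WithLp 2 (L2R N × L2C N))
    (graphMap N s) (graphMap_injective N s)

instance : NormedSpace ℝ (RadialSobolev N s) :=
  NormedSpace.induced ℝ (RadialSobolev N s) (WithLp 2 (L2R N × L2C N)) (graphMap N s)

lemma norm_sq_eq (u : RadialSobolev N s) : ‖u‖ ^ 2 = ‖toL2 u‖ ^ 2 + ‖fracLap u‖ ^ 2 :=
  WithLp.prod_norm_sq_eq_of_L2 (graphMap N s u)

/-- `‖(-Δ)^(s/2) u‖₂²`. -/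
def kinetic (u : RadialSobolev N s) : ℝ := ∫ x, ‖fracLap u x‖ ^ 2

/-- `‖u‖₂²`. -/
def mass (u : RadialSobolev N s) : ℝ := ∫ x, (toL2 u x) ^ 2

end RadialSobolev

/-- The primitive `G(t) = ∫₀ᵗ g(τ) dτ`. -/
def primitive (g : ℝ → ℝ) (t : ℝ) : ℝ := ∫ τ in (0 : ℝ)..t, g τ

/-- Condition (g1): `g` is continuous and `g(t)/t → 0` as `t → 0`. -/
def CondG1 (g : ℝ → ℝ) : Prop :=
  Continuous g ∧ Tendsto (fun t => g t / t) (𝓝[≠] 0) (𝓝 0)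

/-- Condition (g2): `g(t)/|t|^p → 0` as `|t| → ∞`, where `p = 1 + 4s/N`. -/
def CondG2 (N : ℕ) (s : ℝ) (g : ℝ → ℝ) : Prop :=
  Tendsto (fun t => g t / |t| ^ (1 + 4 * s / (N : ℝ))) (comap (fun t : ℝ => |t|) atTop) (𝓝 0)

/-- Condition (g3): `G(t₀) > 0` for some `t₀ > 0`. -/
def CondG3 (g : ℝ → ℝ) : Prop := ∃ t₀ : ℝ, 0 < t₀ ∧ 0 < primitive g t₀

section Functionals

variable {N : ℕ} {s : ℝ}

open RadialSobolev

/-- The Lagrangian functional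
`I(λ, u) = ½ ∫ |(-Δ)^(s/2) u|² - ∫ G(u) + (e^λ / 2) (‖u‖₂² - m)`. -/
def lagrangian (g : ℝ → ℝ) (m : ℝ) (z : ℝ × RadialSobolev N s) : ℝ :=
  (1 / 2) * kinetic z.2 - (∫ x, primitive g (toL2 z.2 x))
    + Real.exp z.1 / 2 * (mass z.2 - m)

/-- The Pohozaev functional
`P(λ, u) = ((N - 2s) / 2) ∫ |(-Δ)^(s/2) u|² + N ∫ ((e^λ / 2) u² - G(u))`. -/
def pohozaev (g : ℝ → ℝ) (z : ℝ × RadialSobolev N s) : ℝ :=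
  ((N : ℝ) - 2 * s) / 2 * kinetic z.2
    + (N : ℝ) * ∫ x, (Real.exp z.1 / 2 * (toL2 z.2 x) ^ 2 - primitive g (toL2 z.2 x))

/-- The partial derivative `∂_λ I (λ, u)`. -/
def partialLam (g : ℝ → ℝ) (m : ℝ) (z : ℝ × RadialSobolev N s) : ℝ :=
  deriv (fun l : ℝ => lagrangian g m (l, z.2)) z.1

/-- The partial derivative `∂_u I (λ, u)`, an element of the dual of `H^s_r(ℝ^N)`. -/
def partialU (g : ℝ → ℝ) (m : ℝ) (z : ℝ × RadialSobolev N s) : RadialSobolev N s →L[ℝ] ℝ :=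
  fderiv ℝ (fun v : RadialSobolev N s => lagrangian g m (z.1, v)) z.2

/-- The Palais-Smale-Pohozaev condition for `I` at level `b`. -/
def PSPCondition (N : ℕ) (s : ℝ) (g : ℝ → ℝ) (m b : ℝ) : Prop :=
  ∀ z : ℕ → ℝ × RadialSobolev N s,
    Tendsto (fun n => lagrangian g m (z n)) atTop (𝓝 b) →
    Tendsto (fun n => partialLam g m (z n)) atTop (𝓝 0) →
    Tendsto (fun n => ‖partialU g m (z n)‖) atTop (𝓝 0) →
    Tendsto (fun n => pohozaev g (z n)) atTop (𝓝 0) →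
    ∃ (w : ℝ × RadialSobolev N s) (φ : ℕ → ℕ),
      StrictMono φ ∧ Tendsto (z ∘ φ) atTop (𝓝 w)

/-- The set of critical points of `I` at level `b` at which `P` vanishes. -/
def criticalPSP (N : ℕ) (s : ℝ) (g : ℝ → ℝ) (m b : ℝ) : Set (ℝ × RadialSobolev N s) :=
  {z | lagrangian g m z = b ∧ partialLam g m z = 0 ∧ partialU g m z = 0 ∧ pohozaev g z = 0}

end Functionals

end FracNLS

end

/-! Boundedness. Subtracting `N` times the Lagrangian from the Pohozaev functional cancels `∫ G(u)`
and leaves `P = N I - s ‖(-Δ)^(s/2) u‖² + (N m / 2) e^λ` (`pohozaev_eq`). Along a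
Palais–Smale–Pohozaev sequence at level `b < 0` this keeps `e^λ` above a positive constant. Then
`∂_λ I → 0` bounds the mass. The exponent `2 + 4s/N` is mass critical: Gagliardo–Nirenberg bounds `∫
|u|^(2+4s/N)` by a power of the mass times the first power of the kinetic energy. Since `g =
o(|t|^p)` at infinity, this term carries an arbitrarily small factor in the bound for `∫ G(u)`, so
`I` bounded above bounds the kinetic energy. The identity then bounds `e^λ` from above
(`exists_bound_of_psp`).

Compactness. Bounded radial sequences have subsequences that are Cauchy in `L^q`, `q = 2 + 4s/N`
(`exists_subseq_tendsto_lintegral`). Frequencies above `R` are uniformly small in `L^q` by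
Gagliardo–Nirenberg. The part below `R` is a pairing of `u` with translates of one `L²` kernel. It
converges pointwise along a weakly Cauchy subsequence, and it decays uniformly at infinity because a
far ball has many disjoint rotated copies carrying equal mass. Testing the difference of two
derivatives `∂_u I` against the difference of the two functions then gives a Cauchy sequence in
`H^s_r` (`cauchySeq_of_psp`), the lower bound on `e^λ` providing coercivity in `L²`.

Regularity. A modulus of continuity for `g` with small growth terms (`exists_abs_sub_le`) makes `u ↦
∫ G(u)` of class `C¹`. Compactness of the critical set is the compactness condition applied to
sequences in it, together with continuity of the four functionals. -/

noncomputable section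

namespace FracNLS

/-! ### Frequency truncation in `L²` and the low-frequency kernel. -/

section

variable {N : ℕ}

open scoped SchwartzMap in
/-- On `L¹ ∩ L²` the inverse Fourier transform is given by the integral. -/
lemma fourierInv_ae_eq_integral (F : L2C N) (hF : Integrable F volume) :
    (𝓕⁻ F : L2C N) =ᵐ[volume] 𝓕⁻ (F : Space N → ℂ) := by
  have hcont : Continuous (𝓕⁻ (F : Space N → ℂ)) := by
    rw [Real.fourierInv_eq_fourier_comp_neg]
    exact VectorFourier.fourierIntegral_continuous Real.continuous_fourierChar
      (by exact continuous_inner) hF.comp_neg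
  refine ae_eq_of_integral_contDiff_smul_eq
    -- Both sides are compared against test functions: the `L²` transform is dual to the Schwartz
    -- one, and the integral transform satisfies the same duality by the multiplication formula.
    ((Lp.memLp (𝓕⁻ F : L2C N)).locallyIntegrable (by norm_num)) hcont.locallyIntegrable ?_
  intro φ hφ hφc
  have h1 : HasCompactSupport (fun x => (φ x : ℂ)) := hφc.comp_left Complex.ofReal_zero
  have h2 : ContDiff ℝ ((⊤ : ℕ∞) : WithTop ℕ∞) (fun x => (φ x : ℂ)) :=
    Complex.ofRealCLM.contDiff.comp hφ
  let ψ : 𝓢(Space N, ℂ) := h1.toSchwartzMap h2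
  have hψ : ∀ x, ψ x = (φ x : ℂ) := fun x => rfl
  have e1 := congrArg (fun T => T ψ) (Lp.fourierInv_toTemperedDistribution_eq F)
  simp only [TemperedDistribution.fourierInv_apply, Lp.toTemperedDistribution_apply] at e1
  have e2 : ∫ x, φ x • (𝓕⁻ F : L2C N) x = ∫ x, ψ x • (𝓕⁻ F : L2C N) x := by
    simp [hψ]
  rw [e2, ← e1]
  have e3 : ∫ x, φ x • 𝓕⁻ (F : Space N → ℂ) x = ∫ x, ψ x • 𝓕⁻ (F : Space N → ℂ) x := by
    simp [hψ]
  rw [e3]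
  have := VectorFourier.integral_fourierIntegral_smul_eq_flip (μ := volume) (ν := volume)
    (L := -innerₗ (Space N)) (f := ψ) (g := F) Real.continuous_fourierChar
    (by exact continuous_inner.neg) ψ.integrable hF
  have a1 : ∀ x, VectorFourier.fourierIntegral Real.fourierChar volume (-innerₗ (Space N)) ψ x
      = (𝓕⁻ ψ) x := by
    intro x
    rw [SchwartzMap.fourierInv_coe]
    simp [VectorFourier.fourierIntegral, Real.fourierInv_eq]
  have a2 : ∀ x, VectorFourier.fourierIntegral Real.fourierChar volume (-innerₗ (Space N)).flip F x
      = 𝓕⁻ (F : Space N → ℂ) x := by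
    intro x
    simp [VectorFourier.fourierIntegral, Real.fourierInv_eq, real_inner_comm]
  simp only [a1, a2] at this
  exact this

/-- The frequency truncation of an `L²` function to a measurable set. -/
def truncate (S : Set (Space N)) (hS : MeasurableSet S) (F : L2C N) : L2C N :=
  ((Lp.memLp F).indicator hS).toLp

lemma truncate_ae (S : Set (Space N)) (hS : MeasurableSet S) (F : L2C N) :
    truncate S hS F =ᵐ[volume] S.indicator F := MemLp.coeFn_toLp _

lemma truncate_add_truncate_compl (S : Set (Space N)) (hS : MeasurableSet S) (F : L2C N) :
    truncate S hS F + truncate Sᶜ hS.compl F = F := by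
  refine Lp.ext ?_
  filter_upwards [Lp.coeFn_add (truncate S hS F) (truncate Sᶜ hS.compl F), truncate_ae S hS F,
    truncate_ae Sᶜ hS.compl F] with x h1 h2 h3
  rw [h1, Pi.add_apply, h2, h3, indicator_self_add_compl_apply]

lemma norm_truncate_le (S : Set (Space N)) (hS : MeasurableSet S) (F : L2C N) :
    ‖truncate S hS F‖ ≤ ‖F‖ := by
  refine Lp.norm_le_norm_of_ae_le ?_
  filter_upwards [truncate_ae S hS F] with x h
  rw [h]
  exact norm_indicator_le_norm_self _ _

lemma integrable_truncate (S : Set (Space N)) (hS : MeasurableSet S) (hS' : volume S ≠ ∞)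
    (F : L2C N) : Integrable (truncate S hS F) volume := by
  refine Integrable.congr ?_ (truncate_ae S hS F).symm
  rw [integrable_indicator_iff hS]
  have : IsFiniteMeasure (volume.restrict S) := ⟨by simpa using hS'.lt_top⟩
  exact ((Lp.memLp F).restrict S).integrable (by norm_num)

/-- The function `ξ ↦ 1_{|ξ| ≤ R} e^{-2πi⟨x, ξ⟩}`. -/
def charFun (R : ℝ) (x ξ : Space N) : ℂ :=
  (Metric.closedBall (0 : Space N) R).indicator
    (fun ξ => ((Real.fourierChar (-(inner ℝ ξ x)) : Circle) : ℂ)) ξ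

lemma norm_charFun (R : ℝ) (x ξ : Space N) :
    ‖charFun R x ξ‖ = (Metric.closedBall (0 : Space N) R).indicator (fun _ => (1 : ℝ)) ξ := by
  by_cases h : ξ ∈ Metric.closedBall (0 : Space N) R <;>
    simp [charFun, h, -Metric.mem_closedBall, Circle.norm_coe]

lemma memLp_charFun (R : ℝ) (x : Space N) : MemLp (charFun R x) 2 volume := by
  have h : MemLp ((Metric.closedBall (0 : Space N) R).indicator (fun _ => (1 : ℝ))) 2 volume :=
    memLp_indicator_const 2 Metric.isClosed_closedBall.measurableSet 1
      (Or.inr (measure_closedBall_lt_top).ne)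
  refine h.mono ?_ (ae_of_all _ fun ξ => ?_)
  · refine AEStronglyMeasurable.indicator ?_ Metric.isClosed_closedBall.measurableSet
    exact (by fun_prop : Continuous fun ξ : Space N =>
      ((Real.fourierChar (-(inner ℝ ξ x)) : Circle) : ℂ)).aestronglyMeasurable
  · rw [norm_charFun]
    exact le_abs_self _

/-- `charFun` as an element of `L²`. -/
def charL2 (R : ℝ) (x : Space N) : L2C N := (memLp_charFun R x).toLp

lemma charL2_ae (R : ℝ) (x : Space N) : charL2 R x =ᵐ[volume] charFun R x := MemLp.coeFn_toLp _

lemma norm_charL2_sq (R : ℝ) (x : Space N) :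
    ‖charL2 R x‖ ^ 2 = volume.real (Metric.closedBall (0 : Space N) R) := by
  rw [← @inner_self_eq_norm_sq ℂ, L2.inner_def]
  have : ∫ a, inner ℂ (charL2 R x a) (charL2 R x a) =
      ∫ a, (Metric.closedBall (0 : Space N) R).indicator (fun _ => (1 : ℂ)) a := by
    refine integral_congr_ae ?_
    filter_upwards [charL2_ae R x] with ξ h
    rw [h, inner_self_eq_norm_sq_to_K, norm_charFun]
    by_cases h : ξ ∈ Metric.closedBall (0 : Space N) R <;> simp [h, -Metric.mem_closedBall]
  rw [this, integral_indicator Metric.isClosed_closedBall.measurableSet]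
  simp

/-- The low frequency part of `f`, with `F = 𝓕 f`, is given pointwise by an `L²` pairing. -/
lemma fourierInv_truncate_ae (R : ℝ) (F : L2C N) :
    (𝓕⁻ (truncate (Metric.closedBall 0 R) Metric.isClosed_closedBall.measurableSet F) : L2C N)
      =ᵐ[volume] fun x => inner ℂ (charL2 R x) F := by
  refine (fourierInv_ae_eq_integral _ (integrable_truncate _ _
    (measure_closedBall_lt_top).ne F)).trans (ae_of_all _ fun x => ?_)
  change _ = inner ℂ (charL2 R x) F
  rw [L2.inner_def, Real.fourierInv_eq]
  refine integral_congr_ae ?_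
  filter_upwards [charL2_ae R x, truncate_ae (Metric.closedBall 0 R)
    Metric.isClosed_closedBall.measurableSet F] with ξ h1 h2
  rw [h1, h2]
  by_cases h : ξ ∈ Metric.closedBall (0 : Space N) R
  · simp [charFun, h, -Metric.mem_closedBall, Circle.smul_def, AddChar.map_neg_eq_inv,
      mul_comm]
  · simp [charFun, h, -Metric.mem_closedBall]

end

/-! ### Mass-critical Gagliardo–Nirenberg inequality by layer cake. -/

section

variable {N : ℕ}

lemma lintegral_ofReal_norm_sq (F : L2C N) :
    ∫⁻ x, ENNReal.ofReal (‖F x‖ ^ 2) = ENNReal.ofReal (‖F‖ ^ 2) := by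
  rw [← @inner_self_eq_norm_sq ℂ, L2.inner_def]
  have h : ∀ a, inner ℂ (F a) (F a) = ((‖F a‖ ^ 2 : ℝ) : ℂ) := fun a => by
    rw [inner_self_eq_norm_sq_to_K]; simp
  simp only [h]
  rw [integral_complex_ofReal, RCLike.re_eq_complex_re, Complex.ofReal_re,
    ofReal_integral_eq_lintegral_ofReal]
  · exact (memLp_two_iff_integrable_sq_norm (Lp.aestronglyMeasurable F)).1 (Lp.memLp F)
  · exact ae_of_all _ fun x => by positivity

lemma norm_charL2_eq (R : ℝ) (hR : 0 ≤ R) (x : Space N) :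
    ‖charL2 R x‖ = √(volume.real (Metric.closedBall (0 : Space N) 1)) * R ^ ((N : ℝ) / 2) := by
  have h := norm_charL2_sq R x
  rw [Measure.addHaar_real_closedBall' volume (0 : Space N) hR, finrank_euclideanSpace_fin] at h
  rw [← Real.sqrt_sq (norm_nonneg (charL2 R x)), h, Real.sqrt_mul (by positivity), mul_comm,
    Real.sqrt_eq_rpow (R ^ N), ← Real.rpow_natCast, ← Real.rpow_mul hR]
  ring_nf

/-- The frequency cut depends on the level `t`: the low part is too small to reach more than `t /
2`, so exceeding `t` forces the high part above `t / 2`. Chebyshev and Plancherel then control the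
measure. -/
lemma volume_norm_gt_le (hN : 0 < N) (F : L2C N) (hF : F ≠ 0) (t : ℝ) (ht : 0 < t) :
    volume {x | t < ‖(𝓕⁻ F : L2C N) x‖} ≤ ENNReal.ofReal (4 / t ^ 2) *
      ∫⁻ ξ, {ξ : Space N | t ≤ 2 * √(volume.real (Metric.closedBall (0 : Space N) 1)) * ‖F‖ *
        ‖ξ‖ ^ ((N : ℝ) / 2)}.indicator (fun ξ => ENNReal.ofReal (‖F ξ‖ ^ 2)) ξ := by
  set κ := √(volume.real (Metric.closedBall (0 : Space N) 1)) with hκ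
  have hκ0 : 0 < κ := by
    refine Real.sqrt_pos.2 (ENNReal.toReal_pos ?_ (measure_closedBall_lt_top).ne)
    exact (Metric.measure_closedBall_pos _ _ one_pos).ne'
  have hM : 0 < ‖F‖ := norm_pos_iff.2 hF
  set a := 2 * κ * ‖F‖ with ha
  have ha0 : 0 < a := by positivity
  have hN' : (0 : ℝ) < N := by exact_mod_cast hN
  -- This radius makes the Cauchy–Schwarz bound `κ R^(N/2) ‖F‖` of the low part equal to `t / 2`.
  set R := (t / a) ^ (2 / (N : ℝ)) with hR
  have hR0 : 0 ≤ R := by positivity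
  have hRN : R ^ ((N : ℝ) / 2) = t / a := by
    rw [hR, ← Real.rpow_mul (by positivity)]
    rw [show 2 / (N : ℝ) * (N / 2) = 1 by field_simp, Real.rpow_one]
  set B := Metric.closedBall (0 : Space N) R
  have hB : MeasurableSet B := Metric.isClosed_closedBall.measurableSet
  set F2 := truncate Bᶜ hB.compl F with hF2
  have hsum : (𝓕⁻ F : L2C N) = 𝓕⁻ (truncate B hB F) + 𝓕⁻ F2 := by
    conv_lhs => rw [← truncate_add_truncate_compl B hB F]
    exact (Lp.fourierTransformₗᵢ (Space N) ℂ).symm.map_add _ _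
  have hsub : volume {x | t < ‖(𝓕⁻ F : L2C N) x‖} ≤
      volume {x | ENNReal.ofReal ((t / 2) ^ 2) ≤ ENNReal.ofReal (‖(𝓕⁻ F2 : L2C N) x‖ ^ 2)} := by
    refine measure_mono_ae ?_
    filter_upwards [fourierInv_truncate_ae R F,
      Lp.coeFn_add (𝓕⁻ (truncate B hB F) : L2C N) (𝓕⁻ F2 : L2C N)] with x h1 h2 h3
    replace h3 : t < ‖(𝓕⁻ (truncate B hB F) + 𝓕⁻ F2 : L2C N) x‖ := hsum ▸ h3
    change ENNReal.ofReal ((t / 2) ^ 2) ≤ ENNReal.ofReal (‖(𝓕⁻ F2 : L2C N) x‖ ^ 2)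
    have h4 : ‖(𝓕⁻ (truncate B hB F) : L2C N) x‖ ≤ t / 2 := by
      rw [h1]
      refine (norm_inner_le_norm _ _).trans ?_
      rw [norm_charL2_eq R hR0 x, hRN, ha]
      apply le_of_eq
      field_simp
      exact hκ.symm
    refine ENNReal.ofReal_le_ofReal ?_
    have h5 : ‖(𝓕⁻ (truncate B hB F) + 𝓕⁻ F2 : L2C N) x‖ ≤
      ‖(𝓕⁻ (truncate B hB F) : L2C N) x‖ + ‖(𝓕⁻ F2 : L2C N) x‖ := by
      rw [h2]; exact norm_add_le _ _
    have h6 : t / 2 ≤ ‖(𝓕⁻ F2 : L2C N) x‖ := by linarith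
    gcongr
  have hcheb := mul_meas_ge_le_lintegral₀ (μ := (volume : Measure (Space N)))
    (f := fun x => ENNReal.ofReal (‖(𝓕⁻ F2 : L2C N) x‖ ^ 2))
    (by have := (Lp.aestronglyMeasurable (𝓕⁻ F2 : L2C N)).aemeasurable; fun_prop)
    (ENNReal.ofReal ((t / 2) ^ 2))
  rw [lintegral_ofReal_norm_sq, show ‖(𝓕⁻ F2 : L2C N)‖ = ‖F2‖ from
    (Lp.fourierTransformₗᵢ (Space N) ℂ).symm.norm_map _, ← lintegral_ofReal_norm_sq] at hcheb
  have hle : ∫⁻ ξ, ENNReal.ofReal (‖F2 ξ‖ ^ 2) ≤ ∫⁻ ξ, {ξ : Space N | t ≤ a *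
        ‖ξ‖ ^ ((N : ℝ) / 2)}.indicator (fun ξ => ENNReal.ofReal (‖F ξ‖ ^ 2)) ξ := by
    refine lintegral_mono_ae ?_
    filter_upwards [truncate_ae Bᶜ hB.compl F] with ξ h
    rw [hF2, h]
    by_cases hξ : ξ ∈ Bᶜ
    · have h7 : R ≤ ‖ξ‖ := by
        simp only [B, mem_compl_iff, Metric.mem_closedBall, dist_zero_right, not_le] at hξ
        exact hξ.le
      have h8 : t ≤ a * ‖ξ‖ ^ ((N : ℝ) / 2) := by
        have : R ^ ((N : ℝ) / 2) ≤ ‖ξ‖ ^ ((N : ℝ) / 2) :=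
          Real.rpow_le_rpow hR0 h7 (by positivity)
        rw [hRN, div_le_iff₀ ha0] at this
        linarith
      rw [indicator_of_mem hξ, indicator_of_mem (by exact h8)]
    · rw [indicator_of_notMem hξ]; simp
  refine hsub.trans ?_
  rw [show 4 / t ^ 2 = ((t / 2) ^ 2)⁻¹ by field_simp; norm_num,
    ENNReal.ofReal_inv_of_pos (by positivity), mul_comm, ← div_eq_mul_inv, ENNReal.le_div_iff_mul_le]
  · rw [mul_comm]; exact hcheb.trans hle
  · left; simpa using ht.ne'
  · left; exact ENNReal.ofReal_ne_top

lemma lintegral_threshold (σ T : ℝ) (hσ : 0 < σ) (hT : 0 ≤ T) :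
    ∫⁻ t in Ioi (0 : ℝ), {t : ℝ | t ≤ T}.indicator (fun t => ENNReal.ofReal (t ^ (σ - 1))) t =
      ENNReal.ofReal (T ^ σ / σ) := by
  have h : MeasurableSet {t : ℝ | t ≤ T} := measurableSet_Iic
  rw [lintegral_indicator h, Measure.restrict_restrict h]
  have h2 : {t : ℝ | t ≤ T} ∩ Ioi 0 = Ioc 0 T := by ext; simp [and_comm]
  rw [h2, ← ofReal_integral_eq_lintegral_ofReal]
  · rw [← intervalIntegral.integral_of_le hT, integral_rpow (Or.inl (by linarith))]
    simp [hσ.ne']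
  · rw [← IntegrableOn, ← intervalIntegrable_iff_integrableOn_Ioc_of_le hT]
    exact intervalIntegral.intervalIntegrable_rpow' (by linarith)
  · filter_upwards [ae_restrict_mem measurableSet_Ioc] with t ht
    exact Real.rpow_nonneg ht.1.le _

/-- The Gagliardo–Nirenberg inequality with the `L²`-critical exponent, on the Fourier side. -/
lemma exists_gagliardoNirenberg (hN : 0 < N) (s : ℝ) (hs : 0 < s) :
    ∃ C : ℝ, 0 ≤ C ∧ ∀ F : L2C N,
      ∫⁻ x, ENNReal.ofReal (‖(𝓕⁻ F : L2C N) x‖ ^ (2 + 4 * s / (N : ℝ))) ≤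
        ENNReal.ofReal (C * ‖F‖ ^ (4 * s / (N : ℝ))) *
          ∫⁻ ξ, ENNReal.ofReal (‖ξ‖ ^ (2 * s) * ‖F ξ‖ ^ 2) := by
  set κ := √(volume.real (Metric.closedBall (0 : Space N) 1)) with hκ
  have hN' : (0 : ℝ) < N := by exact_mod_cast hN
  set σ := 4 * s / (N : ℝ) with hσ
  have hσ0 : 0 < σ := by positivity
  refine ⟨(2 + σ) * (4 * ((2 * κ) ^ σ / σ)), by positivity, fun F => ?_⟩
  by_cases hF : F = 0
  · have h0 : (𝓕⁻ F : L2C N) = 0 := by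
      rw [hF]; exact (Lp.fourierTransformₗᵢ (Space N) ℂ).symm.map_zero
    have : ∫⁻ x, ENNReal.ofReal (‖(𝓕⁻ F : L2C N) x‖ ^ (2 + σ)) = 0 := by
      rw [h0, ← lintegral_zero (μ := (volume : Measure (Space N)))]
      refine lintegral_congr_ae ?_
      filter_upwards [Lp.coeFn_zero ℂ 2 (volume : Measure (Space N))] with x h
      rw [h]
      simp [Real.zero_rpow (by positivity : 2 + σ ≠ 0)]
    rw [this]; exact zero_le
  have hm := (Lp.aestronglyMeasurable (𝓕⁻ F : L2C N)).aemeasurable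
  have hFm := (Lp.stronglyMeasurable F).measurable
  rw [lintegral_rpow_eq_lintegral_meas_lt_mul volume (ae_of_all _ fun x => norm_nonneg _)
    (by fun_prop) (by positivity : 0 < 2 + σ)]
  set a := 2 * κ * ‖F‖ with ha
  have ha0 : 0 ≤ a := by positivity
  -- The layer-cake weight `t^(2+σ-1)` times the Chebyshev factor `4 / t²` leaves `4 t^(σ-1)`,
  -- integrable at `0`.
  let A : ℝ → Space N → ℝ≥0∞ := fun t ξ =>
    {p : ℝ × Space N | p.1 ≤ a * ‖p.2‖ ^ ((N : ℝ) / 2)}.indicator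
      (fun p => ENNReal.ofReal (4 * ‖F p.2‖ ^ 2) * ENNReal.ofReal (p.1 ^ (σ - 1))) (t, ξ)
  have hAm : Measurable (Function.uncurry A) := by
    refine Measurable.indicator (by fun_prop) ?_
    exact measurableSet_le (by fun_prop) (by fun_prop)
  have h1 : ∫⁻ t in Ioi (0 : ℝ), volume {x | t < ‖(𝓕⁻ F : L2C N) x‖} *
      ENNReal.ofReal (t ^ (2 + σ - 1)) ≤ ∫⁻ t in Ioi (0 : ℝ), ∫⁻ ξ, A t ξ := by
    refine setLIntegral_mono' measurableSet_Ioi fun t ht => ?_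
    have ht : 0 < t := ht
    refine (mul_le_mul_left (volume_norm_gt_le hN F hF t ht) _).trans (le_of_eq ?_)
    rw [mul_right_comm, ← ENNReal.ofReal_mul (by positivity), ← lintegral_const_mul']
    · refine lintegral_congr fun ξ => ?_
      simp only [A]
      by_cases h : t ≤ a * ‖ξ‖ ^ ((N : ℝ) / 2)
      · rw [indicator_of_mem (by exact h), indicator_of_mem (by exact h),
          ← ENNReal.ofReal_mul (by positivity), ← ENNReal.ofReal_mul (by positivity)]
        congr 1
        rw [show 2 + σ - 1 = (σ - 1) + (2 : ℕ) by push_cast; ring, Real.rpow_add ht,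
          Real.rpow_natCast]
        field_simp
      · rw [indicator_of_notMem (by exact h), indicator_of_notMem (by exact h), mul_zero]
    · exact ENNReal.ofReal_ne_top
  -- By Tonelli the `t`-integral runs up to `a ‖ξ‖^(N/2)` and produces `‖ξ‖^(Nσ/2)`; as `Nσ/2 = 2s`,
  -- this is exactly the kinetic weight.
  have h2 : ∫⁻ t in Ioi (0 : ℝ), ∫⁻ ξ, A t ξ =
      ENNReal.ofReal (4 * ((2 * κ) ^ σ / σ) * ‖F‖ ^ σ) *
        ∫⁻ ξ, ENNReal.ofReal (‖ξ‖ ^ (2 * s) * ‖F ξ‖ ^ 2) := by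
    rw [lintegral_lintegral_swap hAm.aemeasurable, ← lintegral_const_mul' _ _ ENNReal.ofReal_ne_top]
    refine lintegral_congr fun ξ => ?_
    have e : ∀ t, A t ξ = ENNReal.ofReal (4 * ‖F ξ‖ ^ 2) *
        {t : ℝ | t ≤ a * ‖ξ‖ ^ ((N : ℝ) / 2)}.indicator
          (fun t => ENNReal.ofReal (t ^ (σ - 1))) t := by
      intro t
      simp only [A]
      by_cases h : t ≤ a * ‖ξ‖ ^ ((N : ℝ) / 2)
      · rw [indicator_of_mem (by exact h), indicator_of_mem (by exact h)]
      · rw [indicator_of_notMem (by exact h), indicator_of_notMem (by exact h), mul_zero]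
    simp only [e]
    rw [lintegral_const_mul' _ _ ENNReal.ofReal_ne_top,
      lintegral_threshold σ _ hσ0 (by positivity), ← ENNReal.ofReal_mul (by positivity),
      ← ENNReal.ofReal_mul (by positivity)]
    congr 1
    rw [Real.mul_rpow ha0 (by positivity), ← Real.rpow_mul (norm_nonneg _), ha,
      Real.mul_rpow (by positivity) (norm_nonneg _),
      show (N : ℝ) / 2 * σ = 2 * s by rw [hσ]; field_simp; ring]
    ring
  refine (mul_le_mul_right (h1.trans h2.le) _).trans (le_of_eq ?_)
  rw [← mul_assoc, ← ENNReal.ofReal_mul (by positivity)]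
  ring_nf

end

/-! ### Uniform decay at infinity of radial functions at low frequency. -/

section

variable {N : ℕ}

/-- The reflection exchanging `x` and `y` preserves both volume and the norm, hence the density. -/
lemma setIntegral_closedBall_eq_of_radial {h : Space N → ℝ} {k : ℝ → ℝ}
    (hk : ∀ᵐ x, h x = k ‖x‖) {x y : Space N} (hxy : ‖x‖ = ‖y‖) (r : ℝ) :
    ∫ z in Metric.closedBall x r, h z = ∫ z in Metric.closedBall y r, h z := by
  let A : Space N ≃ₗᵢ[ℝ] Space N := (ℝ ∙ (x - y))ᗮ.reflection
  have hA : A x = y := Submodule.reflection_sub hxy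
  have hmp : MeasurePreserving A volume volume := A.measurePreserving
  have hpre : A ⁻¹' Metric.closedBall y r = Metric.closedBall x r := by
    ext z
    rw [mem_preimage, Metric.mem_closedBall, Metric.mem_closedBall, ← hA, A.dist_map]
  have h1 := hmp.setIntegral_preimage_emb A.toHomeomorph.measurableEmbedding h
    (Metric.closedBall y r)
  rw [← h1, hpre]
  refine integral_congr_ae (ae_restrict_of_ae ?_)
  filter_upwards [hk, hmp.quasiMeasurePreserving.ae hk] with z h2 h3
  rw [h2, h3, A.norm_map]

/-- A radial density puts little mass into balls that are far away from the origin. -/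
lemma exists_radius_mul_setIntegral_le (hN : 2 ≤ N) (n : ℕ) (r : ℝ) :
    ∃ ρ : ℝ, ∀ (h : Space N → ℝ) (k : ℝ → ℝ), Integrable h → (∀ x, 0 ≤ h x) →
      (∀ᵐ x, h x = k ‖x‖) → ∀ x : Space N, ρ ≤ ‖x‖ →
      n * ∫ z in Metric.closedBall x r, h z ≤ ∫ z, h z := by
  have hrank : 1 < Module.rank ℝ (Space N) := by
    rw [← Module.finrank_eq_rank, finrank_euclideanSpace_fin]
    exact_mod_cast hN
  -- In dimension at least two the unit sphere is connected and has two points, so it is infinite.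
  have hinf : (Metric.sphere (0 : Space N) 1).Infinite := by
    refine (isPreconnected_sphere hrank 0 1).infinite_of_nontrivial ?_
    let e : Space N := EuclideanSpace.single ⟨0, by omega⟩ 1
    have he : ‖e‖ = 1 := by simp [e]
    refine ⟨e, by simp [he], -e, by simp [he], fun h => ?_⟩
    have h2 : (2 : ℝ) • e = 0 := by rw [two_smul]; nth_rewrite 1 [h]; exact neg_add_cancel e
    have : e = 0 := (smul_eq_zero.1 h2).resolve_left two_ne_zero
    simp [this] at he
  -- Scaled by a large `‖x‖`, these `n` directions are centres of disjoint balls of radius `r`, each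
  -- carrying the same mass as the ball around `x`.
  obtain ⟨S, hS, hcard⟩ := hinf.exists_subset_card_eq n
  have hev : ∀ᶠ ρ : ℝ in atTop, 0 ≤ ρ ∧ ∀ a ∈ S, ∀ c ∈ S, a ≠ c → 2 * r < ρ * dist a c := by
    refine (eventually_ge_atTop 0).and ?_
    refine (Filter.eventually_all_finset S).2 fun a _ => (Filter.eventually_all_finset S).2
      fun c _ => ?_
    by_cases hac : a = c
    · simp [hac]
    · have : Tendsto (fun ρ : ℝ => ρ * dist a c) atTop atTop :=
        tendsto_id.atTop_mul_const (dist_pos.2 hac)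
      filter_upwards [this.eventually_gt_atTop (2 * r)] with ρ h _ using h
  obtain ⟨ρ, hρ⟩ := eventually_atTop.1 hev
  refine ⟨ρ, fun h k hi h0 hk x hx => ?_⟩
  obtain ⟨-, hsep⟩ := hρ ‖x‖ hx
  have hdisj : (S : Set (Space N)).Pairwise
      (Function.onFun Disjoint fun a => Metric.closedBall (‖x‖ • a) r) := by
    intro a ha c hc hac
    refine Metric.closedBall_disjoint_closedBall ?_
    rw [dist_smul₀, norm_norm]
    linarith [hsep a ha c hc hac]
  have hsum := integral_biUnion_finset (μ := volume) (f := h) S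
    (fun a _ => Metric.isClosed_closedBall.measurableSet) hdisj (fun a _ => hi.integrableOn)
  have hle : ∫ z in ⋃ a ∈ S, Metric.closedBall (‖x‖ • a) r, h z ≤ ∫ z, h z :=
    setIntegral_le_integral hi (ae_of_all _ h0)
  rw [hsum] at hle
  refine le_trans (le_of_eq ?_) hle
  rw [Finset.sum_congr rfl (g := fun _ => ∫ z in Metric.closedBall x r, h z), Finset.sum_const,
    hcard, nsmul_eq_mul]
  intro a ha
  refine setIntegral_closedBall_eq_of_radial hk ?_ r
  have : ‖a‖ = 1 := by simpa using hS ha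
  rw [norm_smul, this, norm_norm, mul_one]

lemma integrable_norm_sq (f : L2C N) : Integrable (fun x => ‖f x‖ ^ 2) volume :=
  (memLp_two_iff_integrable_sq_norm (Lp.aestronglyMeasurable f)).1 (Lp.memLp f)

lemma norm_sq_eq_integral (f : L2C N) : ‖f‖ ^ 2 = ∫ x, ‖f x‖ ^ 2 := by
  have h := lintegral_ofReal_norm_sq f
  rw [← ofReal_integral_eq_lintegral_ofReal (integrable_norm_sq f)
    (ae_of_all _ fun x => by positivity)] at h
  exact ((ENNReal.ofReal_eq_ofReal_iff (integral_nonneg fun x => by positivity)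
    (by positivity)).1 h).symm

lemma norm_truncate_sq (S : Set (Space N)) (hS : MeasurableSet S) (f : L2C N) :
    ‖truncate S hS f‖ ^ 2 = ∫ x in S, ‖f x‖ ^ 2 := by
  rw [norm_sq_eq_integral, ← integral_indicator hS]
  refine integral_congr_ae ?_
  filter_upwards [truncate_ae S hS f] with x h
  rw [h]
  by_cases hx : x ∈ S <;> simp [hx]

lemma inner_truncate (S : Set (Space N)) (hS : MeasurableSet S) (f g : L2C N) :
    inner ℂ g (truncate S hS f) = inner ℂ (truncate S hS g) f := by
  rw [L2.inner_def, L2.inner_def]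
  refine integral_congr_ae ?_
  filter_upwards [truncate_ae S hS f, truncate_ae S hS g] with x h h'
  rw [h, h']
  by_cases hx : x ∈ S <;> simp [hx]

lemma integrable_charL2 (R : ℝ) (x : Space N) : Integrable (charL2 R x) volume := by
  have h : truncate (Metric.closedBall 0 R) Metric.isClosed_closedBall.measurableSet (charL2 R x)
      =ᵐ[volume] charL2 R x := by
    filter_upwards [charL2_ae R x, truncate_ae (Metric.closedBall 0 R)
      Metric.isClosed_closedBall.measurableSet (charL2 R x)] with ξ h1 h2
    rw [h2, h1]
    by_cases h : ξ ∈ Metric.closedBall (0 : Space N) R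
    · rw [indicator_of_mem h, h1]
    · rw [indicator_of_notMem h, charFun, indicator_of_notMem h]
  exact (integrable_truncate _ _ (measure_closedBall_lt_top).ne _).congr h

/-- Modulation in frequency is translation in space, so a single tail estimate for the kernel at `0`
serves every `x`. -/
lemma fourierInv_charL2_ae (R : ℝ) (x : Space N) :
    (𝓕⁻ (charL2 R x) : L2C N) =ᵐ[volume] fun y => 𝓕⁻ (charFun R (0 : Space N)) (y - x) := by
  refine (fourierInv_ae_eq_integral _ (integrable_charL2 R x)).trans (ae_of_all _ fun y => ?_)
  change 𝓕⁻ (charL2 R x : Space N → ℂ) y = 𝓕⁻ (charFun R (0 : Space N)) (y - x)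
  rw [Real.fourierInv_congr_ae (charL2_ae R x), Real.fourierInv_eq, Real.fourierInv_eq]
  refine integral_congr_ae (ae_of_all _ fun ξ => ?_)
  by_cases h : ξ ∈ Metric.closedBall (0 : Space N) R
  · have e : inner ℝ ξ (y - x) = inner ℝ ξ y + -inner ℝ ξ x := by
      rw [inner_sub_right, sub_eq_add_neg]
    simp only [charFun, indicator_of_mem h, Circle.smul_def, smul_eq_mul, e,
      inner_zero_right, neg_zero, AddChar.map_zero_eq_one,
      AddChar.map_add_eq_mul, Circle.coe_mul, Circle.coe_one, mul_one]
  · simp [charFun, h, -Metric.mem_closedBall]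

lemma norm_fourierInv (F : L2C N) : ‖(𝓕⁻ F : L2C N)‖ = ‖F‖ :=
  (Lp.fourierTransformₗᵢ (Space N) ℂ).symm.norm_map F

lemma inner_fourier_right (F f : L2C N) : inner ℂ F (𝓕 f : L2C N) = inner ℂ (𝓕⁻ F : L2C N) f := by
  have h : F = (𝓕 (𝓕⁻ F : L2C N) : L2C N) :=
    ((Lp.fourierTransformₗᵢ (Space N) ℂ).apply_symm_apply F).symm
  conv_lhs => rw [h]
  exact (Lp.fourierTransformₗᵢ (Space N) ℂ).inner_map_map _ _

/-- The low frequency part of a radial function decays at infinity, uniformly in the function. -/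
lemma exists_radius_norm_inner_charL2_le (hN : 2 ≤ N) (R ε : ℝ) (hε : 0 < ε) :
    ∃ ρ : ℝ, ∀ f : L2C N, (∃ k : ℝ → ℝ, ∀ᵐ x, ‖f x‖ = k ‖x‖) → ∀ x : Space N, ρ ≤ ‖x‖ →
      ‖inner ℂ (charL2 R x) (𝓕 f : L2C N)‖ ≤ ε * ‖f‖ := by
  set K : Space N → ℂ := 𝓕⁻ (charFun R (0 : Space N))
  have hK0 : (𝓕⁻ (charL2 R 0) : L2C N) =ᵐ[volume] K := by
    simpa using fourierInv_charL2_ae R (0 : Space N)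
  have hKi : Integrable (fun z => ‖K z‖ ^ 2) volume :=
    (integrable_norm_sq (𝓕⁻ (charL2 R 0) : L2C N)).congr
      (hK0.mono fun z hz => by simp only [hz])
  obtain ⟨r, hr⟩ : ∃ r : ℕ, ∫ z in (Metric.closedBall (0 : Space N) r)ᶜ, ‖K z‖ ^ 2
      ≤ (ε / 2) ^ 2 := by
    have h := tendsto_setIntegral_of_antitone (μ := volume) (f := fun z => ‖K z‖ ^ 2)
      (s := fun r : ℕ => (Metric.closedBall (0 : Space N) r)ᶜ)
      (fun r => Metric.isClosed_closedBall.measurableSet.compl)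
      (fun a c hac => compl_subset_compl.2 (Metric.closedBall_subset_closedBall
        (by exact_mod_cast hac))) ⟨0, hKi.integrableOn⟩
    have hemp : ⋂ r : ℕ, (Metric.closedBall (0 : Space N) r)ᶜ = ∅ := by
      rw [← compl_iUnion, Metric.iUnion_closedBall_nat, compl_univ]
    rw [hemp] at h
    simp only [Measure.restrict_empty, integral_zero_measure] at h
    exact (h.eventually (eventually_le_nhds (by positivity))).exists
  set c := ‖charL2 R (0 : Space N)‖ with hc
  have hcx : ∀ x : Space N, ‖charL2 R x‖ = c := fun x => by
    rw [hc, ← abs_of_nonneg (norm_nonneg (charL2 R x)), ← abs_of_nonneg (norm_nonneg (charL2 R 0)),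
      ← sq_eq_sq_iff_abs_eq_abs, norm_charL2_sq, norm_charL2_sq]
  -- A far ball carries at most `‖f‖² / n` of the mass; this `n` makes `c ‖f‖ / √n` at most `(ε / 2)
  -- ‖f‖`.
  obtain ⟨n, hn⟩ := exists_nat_gt ((2 * c / ε) ^ 2)
  have hn0 : (0 : ℝ) < n := lt_of_le_of_lt (by positivity) hn
  obtain ⟨ρ, hρ⟩ := exists_radius_mul_setIntegral_le hN n r
  refine ⟨ρ, fun f ⟨k, hk⟩ x hx => ?_⟩
  have hB : MeasurableSet (Metric.closedBall x (r : ℝ)) := Metric.isClosed_closedBall.measurableSet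
  set G : L2C N := 𝓕⁻ (charL2 R x) with hG
  -- The pairing is split at the ball around `x`: outside it the kernel is small, inside it `f` has
  -- little mass.
  have h1 : ‖truncate _ hB.compl G‖ ≤ ε / 2 := by
    refine abs_le_of_sq_le_sq' ?_ (by positivity) |>.2
    rw [norm_truncate_sq]
    refine le_trans (le_of_eq ?_) hr
    have e1 : ∫ y in (Metric.closedBall x (r : ℝ))ᶜ, ‖G y‖ ^ 2 =
        ∫ y in (Metric.closedBall x (r : ℝ))ᶜ, ‖K (y - x)‖ ^ 2 :=
      integral_congr_ae (ae_restrict_of_ae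
        ((fourierInv_charL2_ae R x).mono fun y hy => by simp only [hG, hy, K]))
    have hmp : MeasurePreserving (fun y : Space N => y - x) volume volume :=
      measurePreserving_sub_right volume x
    have e2 := hmp.setIntegral_preimage_emb (Homeomorph.subRight x).measurableEmbedding
      (fun z => ‖K z‖ ^ 2) (Metric.closedBall (0 : Space N) r)ᶜ
    rw [e1, ← e2]
    congr 2
    ext y
    simp [dist_eq_norm]
  have h2 : ‖truncate _ hB f‖ * c ≤ ε / 2 * ‖f‖ := by
    have h3 := hρ (fun x => ‖f x‖ ^ 2) (fun t => k t ^ 2) (integrable_norm_sq f)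
      (fun x => by positivity) (hk.mono fun x hx => by rw [hx]) x hx
    rw [← norm_truncate_sq _ hB, ← norm_sq_eq_integral] at h3
    refine abs_le_of_sq_le_sq' ?_ (by positivity) |>.2
    have h4 : c ^ 2 ≤ (ε / 2) ^ 2 * n := by
      have : c ^ 2 = (ε / 2) ^ 2 * (2 * c / ε) ^ 2 := by field_simp
      rw [this]; gcongr
    calc (‖truncate _ hB f‖ * c) ^ 2 = c ^ 2 * ‖truncate _ hB f‖ ^ 2 := by ring
      _ ≤ (ε / 2) ^ 2 * n * ‖truncate _ hB f‖ ^ 2 := by gcongr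
      _ ≤ (ε / 2 * ‖f‖) ^ 2 := by nlinarith [sq_nonneg (ε / 2)]
  rw [inner_fourier_right]
  have h5 : inner ℂ G f = inner ℂ G (truncate _ hB f) + inner ℂ (truncate _ hB.compl G) f := by
    rw [← inner_truncate, ← inner_add_right, truncate_add_truncate_compl]
  rw [← hG, h5]
  have h6 : ‖G‖ = c := by rw [hG, norm_fourierInv, hcx]
  calc _ ≤ ‖G‖ * ‖truncate _ hB f‖ + ‖truncate _ hB.compl G‖ * ‖f‖ :=
        (norm_add_le _ _).trans (add_le_add (norm_inner_le_norm _ _) (norm_inner_le_norm _ _))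
    _ ≤ ε / 2 * ‖f‖ + ε / 2 * ‖f‖ := by
        rw [h6, mul_comm]
        gcongr
    _ = ε * ‖f‖ := by ring

end

/-! ### Compactness of bounded radial sequences in `L^q`. -/

section

/-- Bounded sequences in a separable Hilbert space have weakly Cauchy subsequences. -/
lemma exists_subseq_cauchySeq_inner {E : Type*} [NormedAddCommGroup E] [InnerProductSpace ℂ E]
    [TopologicalSpace.SeparableSpace E] (x : ℕ → E) (B : ℝ) (hB : ∀ n, ‖x n‖ ≤ B) :
    ∃ φ : ℕ → ℕ, StrictMono φ ∧ ∀ w : E, CauchySeq fun n => inner ℂ w (x (φ n)) := by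
  have hB0 : 0 ≤ B := (norm_nonneg _).trans (hB 0)
  let d := TopologicalSpace.denseSeq E
  -- Tychonoff's theorem replaces the diagonal argument: pairings with a dense sequence lie in a
  -- countable product of compact discs.
  have hK : IsCompact (Set.pi univ fun k => Metric.closedBall (0 : ℂ) (‖d k‖ * B)) :=
    isCompact_univ_pi fun k => isCompact_closedBall _ _
  obtain ⟨a, -, φ, hφ, hlim⟩ := hK.tendsto_subseq (x := fun n k => inner ℂ (d k) (x n))
    (fun n k _ => by
      rw [mem_closedBall_zero_iff]
      exact (norm_inner_le_norm _ _).trans (by gcongr; exact hB n))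
  refine ⟨φ, hφ, fun w => Metric.cauchySeq_iff'.2 fun ε hε => ?_⟩
  obtain ⟨k, hk⟩ := (TopologicalSpace.denseRange_denseSeq E).exists_dist_lt w
    (show 0 < ε / (4 * (B + 1)) by positivity)
  have hc : CauchySeq fun n => inner ℂ (d k) (x (φ n)) :=
    ((tendsto_pi_nhds.1 hlim) k).cauchySeq
  obtain ⟨n₀, hn₀⟩ := Metric.cauchySeq_iff'.1 hc (ε / 2) (by positivity)
  refine ⟨n₀, fun n hn => ?_⟩
  have h1 : ∀ n, ‖inner ℂ w (x (φ n)) - inner ℂ (d k) (x (φ n))‖ ≤ ε / 4 := fun n => by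
    rw [← inner_sub_left]
    refine (norm_inner_le_norm _ _).trans ?_
    rw [dist_eq_norm] at hk
    calc ‖w - d k‖ * ‖x (φ n)‖ ≤ ε / (4 * (B + 1)) * B := by gcongr; exact hB _
      _ ≤ ε / (4 * (B + 1)) * (B + 1) := by gcongr; linarith
      _ = ε / 4 := by field_simp
  have h2 := hn₀ n hn
  rw [dist_eq_norm] at h2 ⊢
  have h3 : inner ℂ w (x (φ n)) - inner ℂ w (x (φ n₀)) =
      (inner ℂ w (x (φ n)) - inner ℂ (d k) (x (φ n))) -
      (inner ℂ w (x (φ n₀)) - inner ℂ (d k) (x (φ n₀))) +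
      (inner ℂ (d k) (x (φ n)) - inner ℂ (d k) (x (φ n₀))) := by ring
  rw [h3]
  refine (norm_add_le _ _).trans_lt ?_
  have := norm_sub_le (inner ℂ w (x (φ n)) - inner ℂ (d k) (x (φ n)))
    (inner ℂ w (x (φ n₀)) - inner ℂ (d k) (x (φ n₀)))
  linarith [h1 n, h1 n₀]

lemma add_rpow_le_two_rpow_mul {a b q : ℝ} (ha : 0 ≤ a) (hb : 0 ≤ b) (hq : 0 ≤ q) :
    (a + b) ^ q ≤ 2 ^ q * (a ^ q + b ^ q) := by
  rcases le_total a b with h | h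
  · calc (a + b) ^ q ≤ (2 * b) ^ q := by gcongr; linarith
      _ = 2 ^ q * b ^ q := Real.mul_rpow (by norm_num) hb
      _ ≤ _ := by gcongr; linarith [Real.rpow_nonneg ha q]
  · calc (a + b) ^ q ≤ (2 * a) ^ q := by gcongr; linarith
      _ = 2 ^ q * a ^ q := Real.mul_rpow (by norm_num) ha
      _ ≤ _ := by gcongr; linarith [Real.rpow_nonneg hb q]

variable {N : ℕ}

lemma norm_fourier (f : L2C N) : ‖(𝓕 f : L2C N)‖ = ‖f‖ :=
  (Lp.fourierTransformₗᵢ (Space N) ℂ).norm_map f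

/-- The low frequency parts of a weakly Cauchy sequence of radial functions are Cauchy in `L^q`,
`q > 2`. -/
lemma tendsto_lintegral_lowFrequency (hN : 2 ≤ N) (σ : ℝ) (hσ : 0 < σ) (R B : ℝ) (f : ℕ → L2C N)
    (hB : ∀ n, ‖f n‖ ≤ B) (hrad : ∀ n j, ∃ k : ℝ → ℝ, ∀ᵐ x, ‖(f n - f j) x‖ = k ‖x‖)
    (hf : ∀ w, CauchySeq fun n => inner ℂ w (f n)) :
    Tendsto (fun p : ℕ × ℕ => ∫⁻ x, ENNReal.ofReal
      (‖inner ℂ (charL2 R x) (𝓕 (f p.1 - f p.2) : L2C N)‖ ^ (2 + σ))) atTop (𝓝 0) := by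
  have hB0 : 0 ≤ B := (norm_nonneg _).trans (hB 0)
  set V : ℕ × ℕ → Space N → ℂ := fun p x => inner ℂ (charL2 R x) (𝓕 (f p.1 - f p.2) : L2C N)
  have hd : ∀ p : ℕ × ℕ, ‖f p.1 - f p.2‖ ≤ 2 * B := fun p =>
    (norm_sub_le _ _).trans (by linarith [hB p.1, hB p.2])
  set T : ℕ × ℕ → L2C N := fun p => 𝓕⁻ (truncate (Metric.closedBall 0 R)
    Metric.isClosed_closedBall.measurableSet (𝓕 (f p.1 - f p.2) : L2C N))
  have hVT : ∀ p, T p =ᵐ[volume] V p := fun p => fourierInv_truncate_ae R _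
  have hV2 : ∀ p, ∫⁻ x, ENNReal.ofReal (‖V p x‖ ^ 2) ≤ ENNReal.ofReal ((2 * B) ^ 2) := fun p => by
    calc ∫⁻ x, ENNReal.ofReal (‖V p x‖ ^ 2) = ∫⁻ x, ENNReal.ofReal (‖T p x‖ ^ 2) :=
          lintegral_congr_ae ((hVT p).mono fun x hx => by simp only [hx])
      _ ≤ _ := by
          rw [lintegral_ofReal_norm_sq]
          refine ENNReal.ofReal_le_ofReal ?_
          gcongr
          refine (norm_fourierInv _).le.trans ((norm_truncate_le _ _ _).trans ?_)
          rw [norm_fourier]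
          exact hd p
  have hVb : ∀ p x, ‖V p x‖ ≤ √(volume.real (Metric.closedBall (0 : Space N) R)) * (2 * B) :=
    fun p x => by
      refine (norm_inner_le_norm _ _).trans ?_
      rw [norm_fourier, ← norm_charL2_sq R x, Real.sqrt_sq (norm_nonneg _)]
      gcongr
      exact hd p
  rw [ENNReal.tendsto_nhds_zero]
  intro ε hε
  have hε2 : 0 < ε / 2 := ENNReal.half_pos hε.ne'
  -- Far out `‖V‖ ≤ δ (2B)`, so `‖V‖^(2+σ) ≤ (δ (2B))^σ ‖V‖²`, and the `L²` norm is at most `2B`.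
  obtain ⟨δ, hδε, hδ⟩ : ∃ δ : ℝ, ENNReal.ofReal ((δ * (2 * B)) ^ σ * (2 * B) ^ 2) ≤ ε / 2 ∧
      0 < δ := by
    have hc : Tendsto (fun δ : ℝ => ENNReal.ofReal ((δ * (2 * B)) ^ σ * (2 * B) ^ 2)) (𝓝[>] 0)
        (𝓝 0) := by
      have h1 : Continuous fun δ : ℝ => (δ * (2 * B)) ^ σ * (2 * B) ^ 2 :=
        ((continuous_id.mul continuous_const).rpow_const fun _ => Or.inr hσ.le).mul
          continuous_const
      have h2 := ((ENNReal.continuous_ofReal.comp h1).tendsto 0).mono_left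
        (nhdsWithin_le_nhds (s := Ioi (0 : ℝ)))
      simpa [Function.comp_def, Real.zero_rpow hσ.ne'] using h2
    exact ((hc.eventually (eventually_le_nhds hε2)).and self_mem_nhdsWithin).exists
  obtain ⟨ρ, hρ⟩ := exists_radius_norm_inner_charL2_le hN R δ hδ
  have hBm : MeasurableSet (Metric.closedBall (0 : Space N) ρ) :=
    Metric.isClosed_closedBall.measurableSet
  have hin : Tendsto (fun p : ℕ × ℕ => ∫⁻ x in Metric.closedBall (0 : Space N) ρ,
      ENNReal.ofReal (‖V p x‖ ^ (2 + σ))) atTop (𝓝 0) := by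
    -- Passing to the `L²` representative `T` supplies measurability for dominated convergence; the
    -- pointwise bound and limit come from `V`.
    have hT : ∀ p, ∫⁻ x in Metric.closedBall (0 : Space N) ρ, ENNReal.ofReal (‖V p x‖ ^ (2 + σ)) =
        ∫⁻ x in Metric.closedBall (0 : Space N) ρ, ENNReal.ofReal (‖T p x‖ ^ (2 + σ)) := fun p =>
      lintegral_congr_ae (ae_restrict_of_ae ((hVT p).mono fun x hx => by simp only [hx]))
    simp only [hT]
    have h0 : ∫⁻ _ in Metric.closedBall (0 : Space N) ρ, (0 : ℝ≥0∞) = 0 := by simp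
    rw [← h0]
    refine tendsto_lintegral_filter_of_dominated_convergence
      (fun _ => ENNReal.ofReal
        ((√(volume.real (Metric.closedBall (0 : Space N) R)) * (2 * B)) ^ (2 + σ)))
      (Eventually.of_forall fun p => ?_) (Eventually.of_forall fun p =>
        ae_restrict_of_ae ((hVT p).mono fun x hx => ?_))
      ?_ (ae_restrict_of_ae ((ae_all_iff.2 hVT).mono fun x hx => ?_))
    · exact ((Lp.stronglyMeasurable (T p)).measurable.norm.pow_const _).ennreal_ofReal
    · rw [hx]
      refine ENNReal.ofReal_le_ofReal ?_
      gcongr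
      exact hVb p x
    · rw [lintegral_const]
      refine ENNReal.mul_ne_top ENNReal.ofReal_ne_top ?_
      rw [Measure.restrict_apply_univ]
      exact (measure_closedBall_lt_top).ne
    · have h1 : Tendsto (fun p : ℕ × ℕ => V p x) atTop (𝓝 0) := by
        have hc := hf (𝓕⁻ (charL2 R x) : L2C N)
        have h2 : ∀ p, V p x = inner ℂ (𝓕⁻ (charL2 R x) : L2C N) (f p.1) -
            inner ℂ (𝓕⁻ (charL2 R x) : L2C N) (f p.2) := fun p => by
          simp only [V]
          rw [inner_fourier_right, inner_sub_right]
        simp only [h2]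
        rw [tendsto_zero_iff_norm_tendsto_zero]
        simpa only [dist_eq_norm] using cauchySeq_iff_tendsto_dist_atTop_0.1 hc
      have h3 : Tendsto (fun p : ℕ × ℕ => ‖V p x‖ ^ (2 + σ)) atTop (𝓝 0) := by
        have := (h1.norm).rpow_const (p := 2 + σ) (Or.inr (by positivity))
        simpa [Real.zero_rpow (by positivity : 2 + σ ≠ 0)] using this
      simpa [hx] using ENNReal.tendsto_ofReal h3
  filter_upwards [hin.eventually (eventually_le_nhds hε2)] with p hp
  rw [← lintegral_add_compl _ hBm, ← ENNReal.add_halves ε]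
  refine add_le_add hp (le_trans ?_ hδε)
  calc ∫⁻ x in (Metric.closedBall (0 : Space N) ρ)ᶜ, ENNReal.ofReal (‖V p x‖ ^ (2 + σ))
      ≤ ∫⁻ x in (Metric.closedBall (0 : Space N) ρ)ᶜ,
        ENNReal.ofReal ((δ * (2 * B)) ^ σ) * ENNReal.ofReal (‖V p x‖ ^ 2) := by
        refine setLIntegral_mono' hBm.compl fun x hx => ?_
        rw [← ENNReal.ofReal_mul (by positivity)]
        refine ENNReal.ofReal_le_ofReal ?_
        have hx' : ρ ≤ ‖x‖ := by
          simp only [mem_compl_iff, Metric.mem_closedBall, dist_zero_right, not_le] at hx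
          exact hx.le
        have h1 : ‖V p x‖ ≤ δ * (2 * B) :=
          (hρ _ (hrad p.1 p.2) x hx').trans (by gcongr; exact hd p)
        rw [Real.rpow_add_of_nonneg (norm_nonneg _) (by norm_num) hσ.le, mul_comm, Real.rpow_two]
        gcongr
    _ ≤ ENNReal.ofReal ((δ * (2 * B)) ^ σ) * ∫⁻ x, ENNReal.ofReal (‖V p x‖ ^ 2) := by
        rw [lintegral_const_mul' _ _ ENNReal.ofReal_ne_top]
        gcongr
        exact Measure.restrict_le_self
    _ ≤ _ := by
        rw [ENNReal.ofReal_mul (by positivity)]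
        gcongr
        exact hV2 p

namespace RadialSobolev

variable {s : ℝ}

lemma complexify_ae (u : L2R N) : complexify N u =ᵐ[volume] fun x => (u x : ℂ) :=
  ContinuousLinearMap.coeFn_compLp _ u

lemma norm_complexify (u : L2R N) : ‖complexify N u‖ = ‖u‖ := by
  refine le_antisymm (Lp.norm_le_norm_of_ae_le ?_) (Lp.norm_le_norm_of_ae_le ?_) <;>
  · filter_upwards [complexify_ae u] with x hx
    rw [hx, Complex.norm_real]

lemma norm_fracLap (u : RadialSobolev N s) : ‖fracLap u‖ = ‖(memLp_fracSymbol u).toLp‖ :=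
  norm_fourierInv _

lemma norm_toL2_le (u : RadialSobolev N s) : ‖toL2 u‖ ≤ ‖u‖ := by
  refine abs_le_of_sq_le_sq' ?_ (norm_nonneg _) |>.2
  rw [norm_sq_eq]; nlinarith [sq_nonneg ‖fracLap u‖]

lemma norm_fracLap_le (u : RadialSobolev N s) : ‖fracLap u‖ ≤ ‖u‖ := by
  refine abs_le_of_sq_le_sq' ?_ (norm_nonneg _) |>.2
  rw [norm_sq_eq]; nlinarith [sq_nonneg ‖toL2 u‖]

/-- Since `2π ≥ 1`, the factor `(2π)^(2s)` in the squared symbol can be dropped. -/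
lemma lintegral_rpow_mul_fourier_le (hs : 0 < s) (u : RadialSobolev N s) :
    ∫⁻ ξ, ENNReal.ofReal (‖ξ‖ ^ (2 * s) * ‖fourierL2 N (toL2 u) ξ‖ ^ 2) ≤
      ENNReal.ofReal (‖fracLap u‖ ^ 2) := by
  rw [norm_fracLap, ← lintegral_ofReal_norm_sq]
  refine lintegral_mono_ae ?_
  filter_upwards [(memLp_fracSymbol u).coeFn_toLp] with ξ h
  rw [h]
  refine ENNReal.ofReal_le_ofReal ?_
  rw [fracSymbol, norm_mul, mul_pow, Complex.norm_real, Real.norm_of_nonneg (by positivity),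
    ← Real.rpow_mul_natCast (by positivity), mul_comm s, Nat.cast_ofNat]
  gcongr
  have := Real.pi_gt_three
  nlinarith [norm_nonneg ξ]

end RadialSobolev

open RadialSobolev

/-- The Gagliardo–Nirenberg inequality with the `L²`-critical exponent. -/
lemma exists_gagliardoNirenberg_sobolev (hN : 0 < N) (s : ℝ) (hs : 0 < s) :
    ∃ C : ℝ, 0 ≤ C ∧ ∀ u : RadialSobolev N s,
      ∫⁻ x, ENNReal.ofReal (|toL2 u x| ^ (2 + 4 * s / (N : ℝ))) ≤
        ENNReal.ofReal (C * ‖toL2 u‖ ^ (4 * s / (N : ℝ)) * ‖fracLap u‖ ^ 2) := by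
  obtain ⟨C, hC, h⟩ := exists_gagliardoNirenberg hN s hs
  refine ⟨C, hC, fun u => ?_⟩
  have h1 := h (fourierL2 N (toL2 u))
  have e : (𝓕⁻ (fourierL2 N (toL2 u)) : L2C N) = complexify N (toL2 u) :=
    (Lp.fourierTransformₗᵢ (Space N) ℂ).symm_apply_apply _
  rw [e, show ‖fourierL2 N (toL2 u)‖ = ‖toL2 u‖ from (norm_fourier _).trans (norm_complexify _)]
    at h1
  rw [ENNReal.ofReal_mul (by positivity)]
  refine le_trans (le_of_eq ?_) (h1.trans (by gcongr; exact lintegral_rpow_mul_fourier_le hs u))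
  refine lintegral_congr_ae ?_
  filter_upwards [complexify_ae (toL2 u)] with x hx
  rw [hx, Complex.norm_real, Real.norm_eq_abs]

/-- The high frequency part of an `H^s` function is small in `L^q`. -/
lemma exists_lintegral_highFrequency_le (hN : 0 < N) (s : ℝ) (hs : 0 < s) :
    ∃ C : ℝ, 0 ≤ C ∧ ∀ (R : ℝ), 0 < R → ∀ u : RadialSobolev N s,
      ∫⁻ x, ENNReal.ofReal (‖(𝓕⁻ (truncate (Metric.closedBall 0 R)ᶜ
        Metric.isClosed_closedBall.measurableSet.compl (fourierL2 N (toL2 u))) : L2C N) x‖ ^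
          (2 + 4 * s / (N : ℝ))) ≤
        ENNReal.ofReal (C * (R ^ (-s) * ‖fracLap u‖) ^ (4 * s / (N : ℝ)) * ‖fracLap u‖ ^ 2) := by
  obtain ⟨C, hC, h⟩ := exists_gagliardoNirenberg hN s hs
  refine ⟨C, hC, fun R hR u => ?_⟩
  set F := fourierL2 N (toL2 u)
  set W := truncate (Metric.closedBall 0 R)ᶜ Metric.isClosed_closedBall.measurableSet.compl F
    with hW
  have hWae : ∀ᵐ ξ, W ξ = (Metric.closedBall (0 : Space N) R)ᶜ.indicator F ξ := truncate_ae _ _ _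
  have h1 : ∫⁻ ξ, ENNReal.ofReal (‖ξ‖ ^ (2 * s) * ‖W ξ‖ ^ 2) ≤ ENNReal.ofReal (‖fracLap u‖ ^ 2) := by
    refine le_trans (lintegral_mono_ae ?_) (lintegral_rpow_mul_fourier_le hs u)
    filter_upwards [hWae] with ξ hξ
    rw [hξ]
    refine ENNReal.ofReal_le_ofReal ?_
    gcongr
    exact norm_indicator_le_norm_self _ _
  -- On `‖ξ‖ > R` one has `1 ≤ R^(-2s) ‖ξ‖^(2s)`; the mass factor in Gagliardo–Nirenberg thus gains
  -- a negative power of `R`.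
  have h2 : ‖W‖ ≤ R ^ (-s) * ‖fracLap u‖ := by
    refine abs_le_of_sq_le_sq' ?_ (by positivity) |>.2
    have h3 : ENNReal.ofReal (‖W‖ ^ 2) ≤
        ENNReal.ofReal ((R ^ (-s)) ^ 2) * ENNReal.ofReal (‖fracLap u‖ ^ 2) := by
      refine le_trans ?_ (mul_le_mul_right h1 _)
      rw [← lintegral_ofReal_norm_sq, ← lintegral_const_mul' _ _ ENNReal.ofReal_ne_top]
      refine lintegral_mono_ae ?_
      filter_upwards [hWae] with ξ hξ
      rw [hξ, ← ENNReal.ofReal_mul (by positivity)]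
      refine ENNReal.ofReal_le_ofReal ?_
      by_cases hm : ξ ∈ (Metric.closedBall (0 : Space N) R)ᶜ
      · rw [indicator_of_mem hm, ← mul_assoc]
        refine le_mul_of_one_le_left (by positivity) ?_
        have hR' : R ≤ ‖ξ‖ := by
          simp only [mem_compl_iff, Metric.mem_closedBall, dist_zero_right, not_le] at hm
          exact hm.le
        calc (1 : ℝ) = (R ^ (-s)) ^ 2 * R ^ (2 * s) := by
              rw [← Real.rpow_mul_natCast hR.le, ← Real.rpow_add hR]
              simp; ring_nf; simp
          _ ≤ _ := by gcongr
      · rw [indicator_of_notMem hm]; simp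
    rw [← ENNReal.ofReal_mul (by positivity), ENNReal.ofReal_le_ofReal_iff (by positivity)] at h3
    rw [mul_pow]; exact h3
  refine (h W).trans ((mul_le_mul' (ENNReal.ofReal_le_ofReal ?_) h1).trans_eq
    (ENNReal.ofReal_mul (by positivity)).symm)
  gcongr

/-- A bounded sequence in `H^s_r` has a subsequence that is Cauchy in `L^q`, `q = 2 + 4s/N`. -/
lemma exists_subseq_tendsto_lintegral (hN : 2 ≤ N) (s : ℝ) (hs : 0 < s)
    (u : ℕ → RadialSobolev N s) (B : ℝ) (hB : ∀ n, ‖u n‖ ≤ B) :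
    ∃ φ : ℕ → ℕ, StrictMono φ ∧ Tendsto (fun p : ℕ × ℕ =>
      ∫⁻ x, ENNReal.ofReal (|toL2 (u (φ p.1) - u (φ p.2)) x| ^ (2 + 4 * s / (N : ℝ))))
        atTop (𝓝 0) := by
  have hN' : (0 : ℝ) < N := by exact_mod_cast (by omega : 0 < N)
  have hB0 : 0 ≤ B := (norm_nonneg _).trans (hB 0)
  set σ := 4 * s / (N : ℝ) with hσ
  have hσ0 : 0 < σ := by positivity
  let f : ℕ → L2C N := fun n => complexify N (toL2 (u n))
  have hfB : ∀ n, ‖f n‖ ≤ B := fun n =>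
    (norm_complexify _).le.trans ((norm_toL2_le _).trans (hB n))
  -- Finiteness of the exponent gives separability of `L²`, required to extract a weakly Cauchy
  -- subsequence.
  have : Fact ((2 : ℝ≥0∞) ≠ ∞) := ⟨by norm_num⟩
  obtain ⟨φ, hφ, hcauchy⟩ := exists_subseq_cauchySeq_inner f B hfB
  refine ⟨φ, hφ, ?_⟩
  have hsub : ∀ i j, f i - f j = complexify N (toL2 (u i - u j)) := fun i j => by
    simp only [f]; rw [map_sub, map_sub]
  have hrad : ∀ i j, ∃ k : ℝ → ℝ, ∀ᵐ x, ‖(f i - f j) x‖ = k ‖x‖ := fun i j => by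
    obtain ⟨k, hk⟩ := (u i - u j).2.2
    refine ⟨fun t => |k t|, ?_⟩
    rw [hsub]
    filter_upwards [complexify_ae (toL2 (u i - u j)), hk] with x h1 h2
    rw [h1, Complex.norm_real, Real.norm_eq_abs]
    exact congrArg _ h2
  obtain ⟨C, hC, hhigh⟩ := exists_lintegral_highFrequency_le (by omega : 0 < N) s hs
  rw [ENNReal.tendsto_nhds_zero]
  intro ε hε
  have hε2 : 0 < ε / 2 := ENNReal.half_pos hε.ne'
  obtain ⟨R, hRε, hR⟩ : ∃ R : ℝ, ENNReal.ofReal (2 ^ (2 + σ)) * ENNReal.ofReal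
      (C * (R ^ (-s) * (2 * B)) ^ σ * (2 * B) ^ 2) ≤ ε / 2 ∧ 0 < R := by
    have hc : Tendsto (fun R : ℝ => ENNReal.ofReal (2 ^ (2 + σ)) *
        ENNReal.ofReal (C * (R ^ (-s) * (2 * B)) ^ σ * (2 * B) ^ 2)) atTop (𝓝 0) := by
      have h1 := tendsto_rpow_neg_atTop hs
      have h2 : Tendsto (fun R : ℝ => C * (R ^ (-s) * (2 * B)) ^ σ * (2 * B) ^ 2) atTop
          (𝓝 (C * (0 * (2 * B)) ^ σ * (2 * B) ^ 2)) :=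
        (((h1.mul_const _).rpow_const (Or.inr hσ0.le)).const_mul C).mul_const _
      have h3 := ENNReal.Tendsto.const_mul (a := ENNReal.ofReal (2 ^ (2 + σ)))
        (ENNReal.tendsto_ofReal h2) (Or.inr ENNReal.ofReal_ne_top)
      simpa [Real.zero_rpow hσ0.ne'] using h3
    exact ((hc.eventually (eventually_le_nhds hε2)).and (eventually_gt_atTop 0)).exists
  have hlow := ENNReal.Tendsto.const_mul (a := ENNReal.ofReal (2 ^ (2 + σ)))
    (tendsto_lintegral_lowFrequency hN σ hσ0 R B (f ∘ φ) (fun n => hfB _)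
    (fun i j => hrad _ _) hcauchy) (Or.inr ENNReal.ofReal_ne_top)
  rw [mul_zero] at hlow
  filter_upwards [hlow.eventually (eventually_le_nhds hε2)] with p hp
  set d := u (φ p.1) - u (φ p.2) with hd
  have hdB : ‖fracLap d‖ ≤ 2 * B := (norm_fracLap_le d).trans
    ((norm_sub_le _ _).trans (by linarith [hB (φ p.1), hB (φ p.2)]))
  have hH := hhigh R hR d
  set W : L2C N := 𝓕⁻ (truncate (Metric.closedBall 0 R)ᶜ
        Metric.isClosed_closedBall.measurableSet.compl (fourierL2 N (toL2 d))) with hW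
  simp only [Function.comp_apply, hsub] at hp
  set V : Space N → ℂ := fun x => inner ℂ (charL2 R x) (𝓕 (complexify N (toL2 d)) : L2C N)
  have hWm := (Lp.aestronglyMeasurable W).aemeasurable
  calc ∫⁻ x, ENNReal.ofReal (|toL2 d x| ^ (2 + σ))
      ≤ ∫⁻ x, ENNReal.ofReal (2 ^ (2 + σ)) * (ENNReal.ofReal (‖V x‖ ^ (2 + σ)) +
          ENNReal.ofReal (‖W x‖ ^ (2 + σ))) := by
        refine lintegral_mono_ae ?_
        have hsum : complexify N (toL2 d) = 𝓕⁻ (truncate (Metric.closedBall 0 R)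
            Metric.isClosed_closedBall.measurableSet (fourierL2 N (toL2 d))) + W := by
          have h1 : complexify N (toL2 d) = (𝓕⁻ (fourierL2 N (toL2 d)) : L2C N) :=
            ((Lp.fourierTransformₗᵢ (Space N) ℂ).symm_apply_apply _).symm
          conv_lhs => rw [h1, ← truncate_add_truncate_compl (Metric.closedBall 0 R)
            Metric.isClosed_closedBall.measurableSet (fourierL2 N (toL2 d))]
          exact (Lp.fourierTransformₗᵢ (Space N) ℂ).symm.map_add _ _
        have hae := Lp.coeFn_add (𝓕⁻ (truncate (Metric.closedBall 0 R)
            Metric.isClosed_closedBall.measurableSet (fourierL2 N (toL2 d))) : L2C N) W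
        rw [← hsum] at hae
        filter_upwards [hae, complexify_ae (toL2 d),
          fourierInv_truncate_ae R (fourierL2 N (toL2 d))] with x h1 h2 h3
        rw [Pi.add_apply, h3, h2] at h1
        rw [← ENNReal.ofReal_add (by positivity) (by positivity), ← ENNReal.ofReal_mul
          (by positivity)]
        refine ENNReal.ofReal_le_ofReal ?_
        refine le_trans ?_ (add_rpow_le_two_rpow_mul (norm_nonneg _) (norm_nonneg _)
          (by positivity))
        rw [← Real.norm_eq_abs, ← Complex.norm_real, h1]
        gcongr
        exact norm_add_le _ _
    _ = (ENNReal.ofReal (2 ^ (2 + σ)) * ∫⁻ x, ENNReal.ofReal (‖V x‖ ^ (2 + σ))) +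
        ENNReal.ofReal (2 ^ (2 + σ)) * ∫⁻ x, ENNReal.ofReal (‖W x‖ ^ (2 + σ)) := by
        rw [lintegral_const_mul' _ _ ENNReal.ofReal_ne_top, lintegral_add_right' _ (by fun_prop),
          mul_add]
    _ ≤ ε / 2 + ε / 2 := by
        refine add_le_add hp (le_trans ?_ hRε)
        gcongr
        refine hH.trans (ENNReal.ofReal_le_ofReal ?_)
        gcongr
    _ = ε := ENNReal.add_halves ε

end

/-! ### Pointwise growth and continuity estimates for `g` and `G`. -/

section

section Nonlinearity

variable {g : ℝ → ℝ}

/-- The limit in (g1) ignores `t = 0`; continuity forces `g 0 = 0`, which covers that point. -/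
lemma CondG1.exists_small (hg : CondG1 g) (ε : ℝ) (hε : 0 < ε) :
    ∃ δ : ℝ, 0 < δ ∧ ∀ t, |t| ≤ δ → |g t| ≤ ε * |t| := by
  have hg0 : g 0 = 0 := by
    have h1 : Tendsto g (𝓝[≠] 0) (𝓝 (g 0)) := (hg.1.tendsto 0).mono_left nhdsWithin_le_nhds
    have h2 : Tendsto (fun t => g t / t * t) (𝓝[≠] 0) (𝓝 (0 * 0)) :=
      hg.2.mul (tendsto_id.mono_left nhdsWithin_le_nhds)
    rw [zero_mul] at h2
    refine tendsto_nhds_unique h1 (h2.congr' ?_)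
    filter_upwards [self_mem_nhdsWithin] with t ht
    exact div_mul_cancel₀ _ ht
  have h := Metric.tendsto_nhdsWithin_nhds.1 hg.2 ε hε
  obtain ⟨δ, hδ, h⟩ := h
  refine ⟨δ / 2, by positivity, fun t ht => ?_⟩
  by_cases ht0 : t = 0
  · simp [ht0, hg0]
  · have := h (x := t) ht0 (by rw [dist_zero_right, Real.norm_eq_abs]; linarith)
    rw [dist_zero_right, norm_div, Real.norm_eq_abs, Real.norm_eq_abs,
      div_lt_iff₀ (abs_pos.2 ht0)] at this
    exact this.le

variable {σ : ℝ}

lemma exists_large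
    (hg : Tendsto (fun t => g t / |t| ^ (1 + σ)) (comap (fun t : ℝ => |t|) atTop) (𝓝 0))
    (ε : ℝ) (hε : 0 < ε) :
    ∃ T : ℝ, 0 < T ∧ ∀ t, T ≤ |t| → |g t| ≤ ε * |t| ^ (1 + σ) := by
  have h := (Metric.tendsto_nhds.1 hg ε hε)
  rw [eventually_comap, eventually_atTop] at h
  obtain ⟨T, hT⟩ := h
  refine ⟨max T 1, by positivity, fun t ht => ?_⟩
  have h1 := hT |t| ((le_max_left _ _).trans ht) t rfl
  have ht0 : 0 < |t| := lt_of_lt_of_le one_pos ((le_max_right _ _).trans ht)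
  rw [dist_zero_right, norm_div, Real.norm_eq_abs, Real.norm_eq_abs,
    abs_of_pos (Real.rpow_pos_of_pos ht0 _), div_lt_iff₀ (Real.rpow_pos_of_pos ht0 _)] at h1
  exact h1.le

lemma exists_abs_le_of_abs_le (hg : Continuous g) (T : ℝ) :
    ∃ B : ℝ, 0 < B ∧ ∀ t, |t| ≤ T → |g t| ≤ B := by
  obtain ⟨B, hB⟩ := (isCompact_Icc (a := -T) (b := T)).exists_bound_of_continuousOn
    hg.continuousOn
  exact ⟨max B 1, by positivity, fun t ht => (hB t (abs_le.1 ht)).trans (le_max_left _ _)⟩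

/-- The small factor sits on the linear term because `L²` offers no compactness; the power term,
with a large constant, is handled by convergence in `L^q`. -/
lemma exists_abs_le_eps_linear (hσ : 0 < σ)
    (hg1 : CondG1 g)
    (hg2 : Tendsto (fun t => g t / |t| ^ (1 + σ)) (comap (fun t : ℝ => |t|) atTop) (𝓝 0))
    (ε : ℝ) (hε : 0 < ε) :
    ∃ C : ℝ, 0 ≤ C ∧ ∀ t, |g t| ≤ ε * |t| + C * |t| ^ (1 + σ) := by
  obtain ⟨δ, hδ, h1⟩ := hg1.exists_small ε hε
  obtain ⟨T, hT, h2⟩ := exists_large hg2 1 one_pos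
  obtain ⟨B, hB, h3⟩ := exists_abs_le_of_abs_le hg1.1 T
  refine ⟨max 1 (B / δ ^ (1 + σ)), by positivity, fun t => ?_⟩
  have hp := Real.rpow_nonneg (abs_nonneg t) (1 + σ)
  have hm1 := mul_le_mul_of_nonneg_right (le_max_left 1 (B / δ ^ (1 + σ))) hp
  have hm2 := mul_le_mul_of_nonneg_right (le_max_right 1 (B / δ ^ (1 + σ))) hp
  have he : 0 ≤ ε * |t| := by positivity
  rcases le_total |t| δ with h | h
  · linarith [h1 t h]
  rcases le_total T |t| with h' | h'
  · linarith [h2 t h']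
  · have : B ≤ B / δ ^ (1 + σ) * |t| ^ (1 + σ) := by
      rw [div_mul_eq_mul_div, le_div_iff₀ (by positivity)]
      gcongr
    linarith [h3 t h']

/-- The small factor sits on the critical power, so that its primitive can be absorbed into the
kinetic energy. Here the full strength of (g2) is used. -/
lemma exists_abs_le_eps_power
    (hg1 : CondG1 g)
    (hg2 : Tendsto (fun t => g t / |t| ^ (1 + σ)) (comap (fun t : ℝ => |t|) atTop) (𝓝 0))
    (ε : ℝ) (hε : 0 < ε) :
    ∃ C : ℝ, 0 ≤ C ∧ ∀ t, |g t| ≤ C * |t| + ε * |t| ^ (1 + σ) := by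
  obtain ⟨δ, hδ, h1⟩ := hg1.exists_small 1 one_pos
  obtain ⟨T, hT, h2⟩ := exists_large hg2 ε hε
  obtain ⟨B, hB, h3⟩ := exists_abs_le_of_abs_le hg1.1 T
  refine ⟨max 1 (B / δ), by positivity, fun t => ?_⟩
  have hp := abs_nonneg t
  have hm1 := mul_le_mul_of_nonneg_right (le_max_left 1 (B / δ)) hp
  have hm2 := mul_le_mul_of_nonneg_right (le_max_right 1 (B / δ)) hp
  have he : 0 ≤ ε * |t| ^ (1 + σ) := by positivity
  rcases le_total |t| δ with h | h
  · linarith [h1 t h]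
  rcases le_total T |t| with h' | h'
  · linarith [h2 t h']
  · have : B ≤ B / δ * |t| := by
      rw [div_mul_eq_mul_div, le_div_iff₀ (by positivity)]
      gcongr
    linarith [h3 t h']

/-- A modulus of continuity for the superposition operator of `g`. -/
lemma exists_abs_sub_le
    (hg1 : CondG1 g)
    (hg2 : Tendsto (fun t => g t / |t| ^ (1 + σ)) (comap (fun t : ℝ => |t|) atTop) (𝓝 0))
    (ε : ℝ) (hε : 0 < ε) :
    ∃ C : ℝ, 0 ≤ C ∧ ∀ a c, |g a - g c| ≤
      ε * (|a| + |c| + |a| ^ (1 + σ) + |c| ^ (1 + σ)) + C * |a - c| := by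
  obtain ⟨δ, hδ, h1⟩ := hg1.exists_small ε hε
  obtain ⟨T, hT, h2⟩ := exists_large hg2 ε hε
  obtain ⟨B, hB, h3⟩ := exists_abs_le_of_abs_le hg1.1 T
  have huc : UniformContinuousOn g (Icc (-(T + 1)) (T + 1)) :=
    isCompact_Icc.uniformContinuousOn_of_continuous hg1.1.continuousOn
  -- The tolerance `ε δ` is at most `ε |a|` when `|a| ≥ δ`. Capping the step by `1` below keeps `c`
  -- in the enlarged interval.
  obtain ⟨η, hη, h4⟩ := Metric.uniformContinuousOn_iff.1 huc (ε * δ) (by positivity)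
  set θ := min η 1
  have hθ : 0 < θ := lt_min hη one_pos
  have hpos : ∀ t : ℝ, 0 ≤ |t| ^ (1 + σ) := fun t => Real.rpow_nonneg (abs_nonneg t) _
  have key : ∀ a c, δ ≤ |a| → |a| ≤ T → |g a - g c| ≤
      ε * (|a| + |c| + |a| ^ (1 + σ) + |c| ^ (1 + σ)) + 2 * B / θ * |a - c| := by
    intro a c ha ha'
    have hnn := mul_nonneg hε.le (abs_nonneg c)
    have hnn2 := mul_nonneg hε.le (hpos c)
    have hnn3 := mul_nonneg hε.le (hpos a)
    have hnn4 := mul_nonneg hε.le (abs_nonneg a)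
    rcases lt_or_ge |a - c| θ with h | h
    · have hc : |c| ≤ T + 1 := by
        have : |c| ≤ |a| + |a - c| := by
          have := abs_sub_abs_le_abs_sub c a
          rw [abs_sub_comm] at this; linarith
        linarith [min_le_right η 1]
      have h5 := h4 a (abs_le.1 (by linarith)) c (abs_le.1 hc)
        (by rw [Real.dist_eq]; exact h.trans_le (min_le_left _ _))
      rw [Real.dist_eq] at h5
      have : ε * δ ≤ ε * |a| := by gcongr
      have h6 : 0 ≤ 2 * B / θ * |a - c| := by positivity
      nlinarith
    -- For distant points the bounded values of `g` are paid for by the Lipschitz term.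
    · have h6 : 2 * B ≤ 2 * B / θ * |a - c| := by
        rw [div_mul_eq_mul_div, le_div_iff₀ hθ]
        gcongr
      have h7 : |g c| ≤ B + ε * |c| ^ (1 + σ) := by
        rcases le_total T |c| with h' | h'
        · linarith [h2 c h']
        · linarith [h3 c h']
      have h8 := abs_sub (g a) (g c)
      linarith [h3 a ha']
  refine ⟨2 * B / θ, by positivity, fun a c => ?_⟩
  have out : ∀ t, ¬ (δ ≤ |t| ∧ |t| ≤ T) → |g t| ≤ ε * |t| + ε * |t| ^ (1 + σ) := by
    intro t ht
    have hnn2 := mul_nonneg hε.le (hpos t)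
    have hnn := mul_nonneg hε.le (abs_nonneg t)
    rcases le_total |t| δ with h | h
    · linarith [h1 t h]
    · have : T ≤ |t| := by
        by_contra hc
        exact ht ⟨h, (not_le.1 hc).le⟩
      linarith [h2 t this]
  by_cases ha : δ ≤ |a| ∧ |a| ≤ T
  · exact key a c ha.1 ha.2
  by_cases hc : δ ≤ |c| ∧ |c| ≤ T
  · have := key c a hc.1 hc.2
    rw [abs_sub_comm (g a), abs_sub_comm a]
    linarith
  · have h6 : 0 ≤ 2 * B / θ * |a - c| := by positivity
    have h8 := abs_sub (g a) (g c)
    linarith [out a ha, out c hc]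

lemma exists_abs_primitive_le (hσ : 0 < σ)
    (hg1 : CondG1 g)
    (hg2 : Tendsto (fun t => g t / |t| ^ (1 + σ)) (comap (fun t : ℝ => |t|) atTop) (𝓝 0))
    (ε : ℝ) (hε : 0 < ε) :
    ∃ C : ℝ, 0 ≤ C ∧ ∀ t, |primitive g t| ≤ C * |t| ^ 2 + ε * |t| ^ (2 + σ) := by
  obtain ⟨C, hC, h⟩ := exists_abs_le_eps_power hg1 hg2 ε hε
  refine ⟨C, hC, fun t => ?_⟩
  have h1 : ‖∫ τ in (0 : ℝ)..t, g τ‖ ≤ (C * |t| + ε * |t| ^ (1 + σ)) * |t - 0| := by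
    refine intervalIntegral.norm_integral_le_of_norm_le_const fun τ hτ => (h τ).trans ?_
    have : |τ| ≤ |t| := by
      simpa using abs_sub_left_of_mem_uIcc (uIoc_subset_uIcc hτ)
    gcongr
  rw [sub_zero, add_mul, mul_assoc, mul_assoc] at h1
  refine h1.trans (le_of_eq ?_)
  have e : |t| ^ (1 + σ) * |t| = |t| ^ (2 + σ) := by
    rw [← Real.rpow_add_one' (abs_nonneg t) (by positivity)]; ring_nf
  rw [e, sq]

/-- The modulus of continuity of `g` is integrated over the segment from `a` to `a + h`; this is the
first-order remainder used for differentiability. -/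
lemma exists_abs_primitive_sub_le (hσ : 0 < σ)
    (hg1 : CondG1 g)
    (hg2 : Tendsto (fun t => g t / |t| ^ (1 + σ)) (comap (fun t : ℝ => |t|) atTop) (𝓝 0))
    (ε : ℝ) (hε : 0 < ε) :
    ∃ C : ℝ, 0 ≤ C ∧ ∀ a h, |primitive g (a + h) - primitive g a - g a * h| ≤
      ε * (|a| * |h| + |h| * |h| + |a| ^ (1 + σ) * |h| + |h| ^ (1 + σ) * |h|)
        + C * (|h| * |h|) := by
  -- Absorbs the cost of replacing `|τ|` by `|a| + |h|` and splitting its power, plus the second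
  -- copy of the terms in `a`.
  set c := (2 : ℝ) * 2 ^ (1 + σ) with hc
  have hc2 : 2 ≤ c := by
    have : (1 : ℝ) ≤ 2 ^ (1 + σ) := Real.one_le_rpow (by norm_num) (by positivity)
    linarith
  obtain ⟨C, hC, h⟩ := exists_abs_sub_le hg1 hg2 (ε / c) (by positivity)
  refine ⟨C, hC, fun a k => ?_⟩
  have hi : ∀ x y, IntervalIntegrable g volume x y := fun x y => hg1.1.intervalIntegrable x y
  have e1 : primitive g (a + k) - primitive g a - g a * k = ∫ τ in a..(a + k), (g τ - g a) := by
    rw [intervalIntegral.integral_sub (hi _ _) intervalIntegrable_const,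
      intervalIntegral.integral_const, primitive, primitive,
      intervalIntegral.integral_interval_sub_left (hi _ _) (hi _ _)]
    simp [mul_comm]
  rw [e1]
  have hpa := Real.rpow_nonneg (abs_nonneg a) (1 + σ)
  have hpk := Real.rpow_nonneg (abs_nonneg k) (1 + σ)
  have h1 : ‖∫ τ in a..(a + k), (g τ - g a)‖ ≤
      (ε * (|a| + |k| + |a| ^ (1 + σ) + |k| ^ (1 + σ)) + C * |k|) * |a + k - a| := by
    refine intervalIntegral.norm_integral_le_of_norm_le_const fun τ hτ => (h τ a).trans ?_
    have h2 : |τ - a| ≤ |k| := by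
      simpa using abs_sub_left_of_mem_uIcc (uIoc_subset_uIcc hτ)
    have h3 : |τ| ≤ |a| + |k| := by
      have := abs_sub_abs_le_abs_sub τ a; linarith
    have h4 : |τ| ^ (1 + σ) ≤ 2 ^ (1 + σ) * (|a| ^ (1 + σ) + |k| ^ (1 + σ)) :=
      (Real.rpow_le_rpow (abs_nonneg _) h3 (by positivity)).trans
        (add_rpow_le_two_rpow_mul (abs_nonneg _) (abs_nonneg _) (by positivity))
    refine add_le_add ?_ (by gcongr)
    rw [div_mul_eq_mul_div, div_le_iff₀ (by positivity), mul_assoc]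
    gcongr
    nlinarith [abs_nonneg a, abs_nonneg k]
  rw [add_sub_cancel_left] at h1
  refine h1.trans (le_of_eq ?_)
  ring

end Nonlinearity

end

/-! ### `L^q` integrals, Hölder's inequality and the Sobolev embedding. -/

section

variable {N : ℕ}

open RadialSobolev

/-- `(∫ |f|^(2+σ))^(1/(2+σ))`. -/
def lqNorm (σ : ℝ) (f : Space N → ℝ) : ℝ := (∫ x, |f x| ^ (2 + σ)) ^ (1 / (2 + σ))

lemma lqNorm_nonneg (σ : ℝ) (f : Space N → ℝ) : 0 ≤ lqNorm σ f :=
  Real.rpow_nonneg (integral_nonneg fun _ => Real.rpow_nonneg (abs_nonneg _) _) _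

lemma integrable_rpow_mul {σ : ℝ} (hσ : 0 < σ) {f h : Space N → ℝ}
    (hf : AEStronglyMeasurable f volume) (hh : AEStronglyMeasurable h volume)
    (hfi : Integrable fun x => |f x| ^ (2 + σ)) (hhi : Integrable fun x => |h x| ^ (2 + σ)) :
    Integrable fun x => |f x| ^ (1 + σ) * |h x| := by
  have hfm := hf.aemeasurable
  have hhm := hh.aemeasurable
  refine (hfi.add hhi).mono' (AEMeasurable.aestronglyMeasurable (by fun_prop))
    (ae_of_all _ fun x => ?_)
  have e : ∀ t : ℝ, |t| ^ (2 + σ) = |t| ^ (1 + σ) * |t| := fun t => by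
    rw [← Real.rpow_add_one' (abs_nonneg t) (by positivity)]; ring_nf
  rw [Real.norm_of_nonneg (by positivity), Pi.add_apply]
  have h1 := Real.rpow_nonneg (abs_nonneg (f x)) (2 + σ)
  have h2 := Real.rpow_nonneg (abs_nonneg (h x)) (2 + σ)
  rcases le_total |f x| |h x| with h' | h'
  · calc |f x| ^ (1 + σ) * |h x| ≤ |h x| ^ (1 + σ) * |h x| := by gcongr
      _ = |h x| ^ (2 + σ) := (e _).symm
      _ ≤ _ := by linarith
  · calc |f x| ^ (1 + σ) * |h x| ≤ |f x| ^ (1 + σ) * |f x| := by gcongr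
      _ = |f x| ^ (2 + σ) := (e _).symm
      _ ≤ _ := by linarith

lemma integral_rpow_mul_le {σ : ℝ} (hσ : 0 < σ) {f h : Space N → ℝ}
    (hf : AEStronglyMeasurable f volume) (hh : AEStronglyMeasurable h volume)
    (hfi : Integrable fun x => |f x| ^ (2 + σ)) (hhi : Integrable fun x => |h x| ^ (2 + σ)) :
    ∫ x, |f x| ^ (1 + σ) * |h x| ≤ lqNorm σ f ^ (1 + σ) * lqNorm σ h := by
  have hfm := hf.aemeasurable
  have hhm := hh.aemeasurable
  have hpq : ((2 + σ) / (1 + σ)).HolderConjugate (2 + σ) := by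
    rw [Real.holderConjugate_iff]
    refine ⟨by rw [lt_div_iff₀ (by positivity)]; linarith, ?_⟩
    field_simp; ring
  have e1 : ∀ x, (|f x| ^ (1 + σ)) ^ ((2 + σ) / (1 + σ)) = |f x| ^ (2 + σ) := fun x => by
    rw [← Real.rpow_mul (abs_nonneg _)]; congr 1; field_simp
  have mem : ∀ (p : ℝ) (k : Space N → ℝ), 0 < p → (∀ x, 0 ≤ k x) → AEStronglyMeasurable k volume →
      Integrable (fun x => k x ^ p) → MemLp k (ENNReal.ofReal p) volume := by
    intro p k hp hk hkm hki
    rw [← integrable_norm_rpow_iff hkm (by simpa using hp) ENNReal.ofReal_ne_top,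
      ENNReal.toReal_ofReal hp.le]
    simpa only [Real.norm_of_nonneg (hk _)] using hki
  have := integral_mul_le_Lp_mul_Lq_of_nonneg (μ := (volume : Measure (Space N))) hpq
    (f := fun x => |f x| ^ (1 + σ)) (g := fun x => |h x|)
    (ae_of_all _ fun x => by positivity) (ae_of_all _ fun x => by positivity)
    (mem _ _ (by positivity) (fun x => by positivity)
      (AEMeasurable.aestronglyMeasurable (by fun_prop)) (by simpa only [e1] using hfi))
    (mem _ _ (by positivity) (fun x => by positivity)
      (AEMeasurable.aestronglyMeasurable (by fun_prop)) hhi)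
  simp only [e1] at this
  refine this.trans (le_of_eq ?_)
  rw [lqNorm, lqNorm, ← Real.rpow_mul (integral_nonneg fun _ => by positivity)]
  congr 2
  field_simp

lemma integrable_abs_mul_abs (u v : L2R N) : Integrable fun x => |u x| * |v x| :=
  (Lp.memLp u).norm.integrable_mul (Lp.memLp v).norm

lemma integral_abs_mul_abs_le (u v : L2R N) : ∫ x, |u x| * |v x| ≤ ‖u‖ * ‖v‖ := by
  have h := real_inner_le_norm (|u|) (|v|)
  rw [norm_abs_eq_norm, norm_abs_eq_norm, L2.inner_def] at h
  refine le_trans (le_of_eq (integral_congr_ae ?_)) h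
  filter_upwards [Lp.coeFn_abs u, Lp.coeFn_abs v] with x h1 h2
  rw [h1, h2]
  simp [mul_comm]

lemma integrable_abs_sq (u : L2R N) : Integrable fun x => |u x| ^ 2 := by
  simpa only [sq] using integrable_abs_mul_abs u u

lemma integral_abs_sq (u : L2R N) : ∫ x, |u x| ^ 2 = ‖u‖ ^ 2 := by
  rw [← real_inner_self_eq_norm_sq, L2.inner_def]
  refine integral_congr_ae (ae_of_all _ fun x => ?_)
  simp [sq]

section Sobolev

variable {s : ℝ}

lemma aestronglyMeasurable_toL2 (u : RadialSobolev N s) :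
    AEStronglyMeasurable (toL2 u) volume := Lp.aestronglyMeasurable _

lemma integrable_rpow_toL2 (hN : 0 < N) (hs : 0 < s) (u : RadialSobolev N s) :
    Integrable fun x => |toL2 u x| ^ (2 + 4 * s / (N : ℝ)) := by
  obtain ⟨C, -, h⟩ := exists_gagliardoNirenberg_sobolev hN s hs
  have hm := (aestronglyMeasurable_toL2 u).aemeasurable
  refine (lintegral_ofReal_ne_top_iff_integrable
    (AEMeasurable.aestronglyMeasurable (by fun_prop)) (ae_of_all _ fun x => by positivity)).1
    ((h u).trans_lt ENNReal.ofReal_lt_top).ne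

lemma exists_integral_rpow_le (hN : 0 < N) (hs : 0 < s) :
    ∃ C : ℝ, 0 ≤ C ∧ ∀ u : RadialSobolev N s, ∫ x, |toL2 u x| ^ (2 + 4 * s / (N : ℝ)) ≤
      C * ‖toL2 u‖ ^ (4 * s / (N : ℝ)) * ‖fracLap u‖ ^ 2 := by
  obtain ⟨C, hC, h⟩ := exists_gagliardoNirenberg_sobolev hN s hs
  refine ⟨C, hC, fun u => ?_⟩
  have h1 := h u
  rwa [← ofReal_integral_eq_lintegral_ofReal (integrable_rpow_toL2 hN hs u)
    (ae_of_all _ fun x => by positivity), ENNReal.ofReal_le_ofReal_iff (by positivity)] at h1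

/-- The Sobolev embedding of `H^s` into `L^q`, `q = 2 + 4s/N`. -/
lemma exists_lqNorm_le (hN : 0 < N) (hs : 0 < s) :
    ∃ S : ℝ, 0 ≤ S ∧ ∀ u : RadialSobolev N s, lqNorm (4 * s / (N : ℝ)) (toL2 u) ≤ S * ‖u‖ := by
  obtain ⟨C, hC, h⟩ := exists_integral_rpow_le hN hs
  have hN' : (0 : ℝ) < N := by exact_mod_cast hN
  set σ := 4 * s / (N : ℝ)
  have hσ : 0 < σ := by positivity
  refine ⟨C ^ (1 / (2 + σ)), by positivity, fun u => ?_⟩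
  have h1 : ∫ x, |toL2 u x| ^ (2 + σ) ≤ C * ‖u‖ ^ (2 + σ) := by
    refine (h u).trans ?_
    rw [mul_assoc, add_comm 2 σ, Real.rpow_add_of_nonneg (norm_nonneg _) hσ.le (by norm_num),
      Real.rpow_two]
    have h1 := norm_toL2_le u
    have h2 := norm_fracLap_le u
    gcongr
  rw [lqNorm]
  refine (Real.rpow_le_rpow (integral_nonneg fun _ => by positivity) h1 (by positivity)).trans
    (le_of_eq ?_)
  rw [Real.mul_rpow hC (by positivity), ← Real.rpow_mul (norm_nonneg _), mul_one_div,
    div_self (by positivity), Real.rpow_one]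

lemma integrable_rpow_mul_toL2 (hN : 0 < N) (hs : 0 < s) (u h : RadialSobolev N s) :
    Integrable fun x => |toL2 u x| ^ (1 + 4 * s / (N : ℝ)) * |toL2 h x| :=
  integrable_rpow_mul (by positivity) (aestronglyMeasurable_toL2 u)
    (aestronglyMeasurable_toL2 h) (integrable_rpow_toL2 hN hs u) (integrable_rpow_toL2 hN hs h)

lemma exists_integral_rpow_mul_le (hN : 0 < N) (hs : 0 < s) :
    ∃ S : ℝ, 0 ≤ S ∧ ∀ u h : RadialSobolev N s,
      ∫ x, |toL2 u x| ^ (1 + 4 * s / (N : ℝ)) * |toL2 h x| ≤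
        S * ‖u‖ ^ (1 + 4 * s / (N : ℝ)) * ‖h‖ := by
  obtain ⟨S, hS, hemb⟩ := exists_lqNorm_le (N := N) hN hs
  have hN' : (0 : ℝ) < N := by exact_mod_cast hN
  set σ := 4 * s / (N : ℝ)
  have hσ : 0 < σ := by positivity
  refine ⟨S ^ (1 + σ) * S, by positivity, fun u h => ?_⟩
  refine (integral_rpow_mul_le hσ (aestronglyMeasurable_toL2 u)
    (aestronglyMeasurable_toL2 h) (integrable_rpow_toL2 hN hs u)
    (integrable_rpow_toL2 hN hs h)).trans ?_
  calc lqNorm σ (toL2 u) ^ (1 + σ) * lqNorm σ (toL2 h)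
      ≤ (S * ‖u‖) ^ (1 + σ) * (S * ‖h‖) := by
        have h1 := hemb u
        have h2 := hemb h
        have h3 := lqNorm_nonneg σ (toL2 u)
        have h4 := lqNorm_nonneg σ (toL2 h)
        gcongr
    _ = _ := by rw [Real.mul_rpow hS (norm_nonneg _)]; ring

end Sobolev

end

/-! ### The potential energy as a `C¹` functional. -/

section

variable {N : ℕ} {s : ℝ} {g : ℝ → ℝ}

open RadialSobolev

lemma continuous_primitive (hg : Continuous g) : Continuous (primitive g) :=
  intervalIntegral.continuous_primitive (fun a b => hg.intervalIntegrable a b) 0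

lemma exists_integral_abs_primitive_le (hN : 0 < N) (hs : 0 < s) (hg1 : CondG1 g)
    (hg2 : CondG2 N s g) (ε : ℝ) (hε : 0 < ε) :
    ∃ C : ℝ, 0 ≤ C ∧ ∀ u : RadialSobolev N s,
      Integrable (fun x => primitive g (toL2 u x)) ∧
      |∫ x, primitive g (toL2 u x)| ≤
        C * ‖toL2 u‖ ^ 2 + ε * ∫ x, |toL2 u x| ^ (2 + 4 * s / (N : ℝ)) := by
  have hN' : (0 : ℝ) < N := by exact_mod_cast hN
  obtain ⟨C, hC, h⟩ := exists_abs_primitive_le (by positivity) hg1 hg2 ε hε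
  refine ⟨C, hC, fun u => ?_⟩
  have hi1 := (integrable_abs_sq (toL2 u)).const_mul C
  have hi2 := (integrable_rpow_toL2 hN hs u).const_mul ε
  have hdom : Integrable (fun x => primitive g (toL2 u x)) := by
    refine (hi1.add hi2).mono' ?_ (ae_of_all _ fun x => h _)
    exact (continuous_primitive hg1.1).comp_aestronglyMeasurable (aestronglyMeasurable_toL2 u)
  refine ⟨hdom, ?_⟩
  rw [← integral_abs_sq, ← integral_const_mul, ← integral_const_mul, ← integral_add hi1 hi2]
  exact (abs_integral_le_integral_abs).trans
    (integral_mono hdom.abs (hi1.add hi2) fun x => h _)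

lemma exists_abs_integral_mul_le (hN : 0 < N) (hs : 0 < s) (hg1 : CondG1 g)
    (hg2 : CondG2 N s g) (ε : ℝ) (hε : 0 < ε) :
    ∃ C : ℝ, 0 ≤ C ∧ ∀ u h : RadialSobolev N s,
      Integrable (fun x => g (toL2 u x) * toL2 h x) ∧
      |∫ x, g (toL2 u x) * toL2 h x| ≤ ε * (‖toL2 u‖ * ‖toL2 h‖) +
        C * ∫ x, |toL2 u x| ^ (1 + 4 * s / (N : ℝ)) * |toL2 h x| := by
  have hN' : (0 : ℝ) < N := by exact_mod_cast hN
  obtain ⟨C, hC, hb⟩ := exists_abs_le_eps_linear (by positivity) hg1 hg2 ε hε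
  refine ⟨C, hC, fun u h => ?_⟩
  have hi1 := (integrable_abs_mul_abs (toL2 u) (toL2 h)).const_mul ε
  have hi2 := (integrable_rpow_mul_toL2 hN hs u h).const_mul C
  have hpt : ∀ x, |g (toL2 u x) * toL2 h x| ≤ ε * (|toL2 u x| * |toL2 h x|) +
      C * (|toL2 u x| ^ (1 + 4 * s / (N : ℝ)) * |toL2 h x|) := fun x => by
    rw [abs_mul, ← mul_assoc, ← mul_assoc, ← add_mul]
    gcongr
    exact hb _
  have hdom : Integrable (fun x => g (toL2 u x) * toL2 h x) := by
    refine (hi1.add hi2).mono' ?_ (ae_of_all _ hpt)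
    exact (hg1.1.comp_aestronglyMeasurable (aestronglyMeasurable_toL2 u)).mul
      (aestronglyMeasurable_toL2 h)
  refine ⟨hdom, (abs_integral_le_integral_abs).trans
    ((integral_mono hdom.abs (hi1.add hi2) hpt).trans ?_)⟩
  simp only [Pi.add_apply]
  rw [integral_add hi1 hi2, integral_const_mul, integral_const_mul]
  have := integral_abs_mul_abs_le (toL2 u) (toL2 h)
  gcongr

lemma integral_linear_combination {α : Type*} [MeasurableSpace α] {μ : Measure α}
    {f₁ f₂ f₃ f₄ f₅ : α → ℝ} (h₁ : Integrable f₁ μ) (h₂ : Integrable f₂ μ) (h₃ : Integrable f₃ μ)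
    (h₄ : Integrable f₄ μ) (h₅ : Integrable f₅ μ) (ε C : ℝ) :
    ∫ x, (ε * (f₁ x + f₂ x + f₃ x + f₄ x) + C * f₅ x) ∂μ =
      ε * ((∫ x, f₁ x ∂μ) + (∫ x, f₂ x ∂μ) + (∫ x, f₃ x ∂μ) + (∫ x, f₄ x ∂μ)) +
        C * ∫ x, f₅ x ∂μ := by
  rw [← integral_add' h₁ h₂, ← integral_add' (h₁.add h₂) h₃,
    ← integral_add' ((h₁.add h₂).add h₃) h₄, ← integral_const_mul, ← integral_const_mul,
    ← integral_add ((((h₁.add h₂).add h₃).add h₄).const_mul ε) (h₅.const_mul C)]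
  rfl

/-- The functional `u ↦ ∫ G(u)` is continuously differentiable on `H^s_r`. -/
lemma exists_hasFDerivAt_integral_primitive (hN : 0 < N) (hs : 0 < s) (hg1 : CondG1 g)
    (hg2 : CondG2 N s g) :
    ∃ D : RadialSobolev N s → RadialSobolev N s →L[ℝ] ℝ,
      (∀ u h, D u h = ∫ x, g (toL2 u x) * toL2 h x) ∧ Continuous D ∧
      ∀ u, HasFDerivAt (fun v : RadialSobolev N s => ∫ x, primitive g (toL2 v x)) (D u) u := by
  have hN' : (0 : ℝ) < N := by exact_mod_cast hN
  obtain ⟨S, hS, hHol⟩ := exists_integral_rpow_mul_le (N := N) (s := s) hN hs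
  obtain ⟨C₁, hC₁, hb⟩ := exists_abs_integral_mul_le (N := N) (s := s) hN hs hg1 hg2 1 one_pos
  have hHol2 : ∀ u h : RadialSobolev N s, ∫ x, |toL2 u x| * |toL2 h x| ≤ ‖u‖ * ‖h‖ := fun u h =>
    (integral_abs_mul_abs_le _ _).trans
      (mul_le_mul (norm_toL2_le u) (norm_toL2_le h) (norm_nonneg _) (norm_nonneg _))
  set σ := 4 * s / (N : ℝ) with hσdef
  have hσ : 0 < σ := by positivity
  let D : RadialSobolev N s → RadialSobolev N s →L[ℝ] ℝ := fun u =>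
    LinearMap.mkContinuous
      { toFun := fun h => ∫ x, g (toL2 u x) * toL2 h x
        map_add' := fun h k => by
          rw [← integral_add (hb u h).1 (hb u k).1]
          refine integral_congr_ae ?_
          filter_upwards [Lp.coeFn_add (toL2 h) (toL2 k)] with x hx
          rw [map_add, hx, Pi.add_apply, mul_add]
        map_smul' := fun c h => by
          rw [RingHom.id_apply, smul_eq_mul, ← integral_const_mul]
          refine integral_congr_ae ?_
          filter_upwards [Lp.coeFn_smul c (toL2 h)] with x hx
          rw [map_smul, hx, Pi.smul_apply, smul_eq_mul]
          ring }
      (‖u‖ + C₁ * (S * ‖u‖ ^ (1 + σ))) (fun h => by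
        refine (hb u h).2.trans ?_
        have h1 := hHol u h
        have h2 := norm_toL2_le u
        have h3 := norm_toL2_le h
        rw [one_mul, add_mul, mul_assoc C₁]
        gcongr)
  have hD : ∀ u h, D u h = ∫ x, g (toL2 u x) * toL2 h x := fun u h => rfl
  refine ⟨D, hD, ?_, ?_⟩
  · have hdiff : ∀ ε : ℝ, 0 < ε → ∃ C : ℝ, 0 ≤ C ∧ ∀ u v, ‖D u - D v‖ ≤
        ε * (‖u‖ + ‖v‖ + S * ‖u‖ ^ (1 + σ) + S * ‖v‖ ^ (1 + σ)) + C * ‖u - v‖ := by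
      intro ε hε
      obtain ⟨C, hC, hpt⟩ := exists_abs_sub_le hg1 hg2 ε hε
      refine ⟨C, hC, fun u v => ContinuousLinearMap.opNorm_le_bound _ (by positivity) fun h => ?_⟩
      have i1 := integrable_abs_mul_abs (toL2 u) (toL2 h)
      have i2 := integrable_abs_mul_abs (toL2 v) (toL2 h)
      have i3 := integrable_rpow_mul_toL2 hN hs u h
      have i4 := integrable_rpow_mul_toL2 hN hs v h
      have i5 := integrable_abs_mul_abs (toL2 (u - v)) (toL2 h)
      rw [sub_apply, hD, hD, ← integral_sub (hb u h).1 (hb v h).1,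
        Real.norm_eq_abs]
      calc |∫ x, (g (toL2 u x) * toL2 h x - g (toL2 v x) * toL2 h x)|
          ≤ ∫ x, |g (toL2 u x) * toL2 h x - g (toL2 v x) * toL2 h x| :=
            abs_integral_le_integral_abs
        _ ≤ ∫ x, (ε * (|toL2 u x| * |toL2 h x| + |toL2 v x| * |toL2 h x| +
              |toL2 u x| ^ (1 + σ) * |toL2 h x| + |toL2 v x| ^ (1 + σ) * |toL2 h x|) +
              C * (|toL2 (u - v) x| * |toL2 h x|)) := by
            refine integral_mono_ae ((hb u h).1.sub (hb v h).1).abs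
              (((((i1.add i2).add i3).add i4).const_mul ε).add (i5.const_mul C)) ?_
            filter_upwards [Lp.coeFn_sub (toL2 u) (toL2 v)] with x hx
            rw [map_sub, hx, Pi.sub_apply, ← sub_mul, abs_mul]
            refine (mul_le_mul_of_nonneg_right (hpt _ _) (abs_nonneg _)).trans (le_of_eq ?_)
            ring
        _ = ε * ((∫ x, |toL2 u x| * |toL2 h x|) + (∫ x, |toL2 v x| * |toL2 h x|) +
              (∫ x, |toL2 u x| ^ (1 + σ) * |toL2 h x|) +
              (∫ x, |toL2 v x| ^ (1 + σ) * |toL2 h x|)) +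
              C * ∫ x, |toL2 (u - v) x| * |toL2 h x| := 
            integral_linear_combination i1 i2 i3 i4 i5 ε C
        _ ≤ ε * (‖u‖ * ‖h‖ + ‖v‖ * ‖h‖ + S * ‖u‖ ^ (1 + σ) * ‖h‖ + S * ‖v‖ ^ (1 + σ) * ‖h‖) +
              C * (‖u - v‖ * ‖h‖) := by
            have := hHol2 u h
            have := hHol2 v h
            have := hHol2 (u - v) h
            have := hHol u h
            have := hHol v h
            gcongr
        _ = _ := by ring
    rw [continuous_iff_continuousAt]
    intro v
    rw [ContinuousAt, tendsto_iff_norm_sub_tendsto_zero, Metric.tendsto_nhds]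
    intro η hη
    -- Bounds the growth factor for every `u` in the unit ball around `v`, so each half of the
    -- estimate costs `η / 2`.
    set K := (‖v‖ + 1) + ‖v‖ + S * (‖v‖ + 1) ^ (1 + σ) + S * ‖v‖ ^ (1 + σ) with hK
    have hK0 : 0 < K := by positivity
    obtain ⟨C, hC, hbd⟩ := hdiff (η / (2 * K)) (by positivity)
    have hδ : 0 < min 1 (η / (2 * (C + 1))) := by positivity
    filter_upwards [Metric.ball_mem_nhds v hδ] with u hu
    rw [Metric.mem_ball, dist_eq_norm] at hu
    rw [dist_zero_right, norm_norm]
    have hu1 : ‖u‖ ≤ ‖v‖ + 1 := by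
      have := norm_sub_norm_le u v
      linarith [min_le_left 1 (η / (2 * (C + 1)))]
    have hu2 : ‖u - v‖ < η / (2 * (C + 1)) := hu.trans_le (min_le_right _ _)
    calc ‖D u - D v‖ ≤ η / (2 * K) * (‖u‖ + ‖v‖ + S * ‖u‖ ^ (1 + σ) + S * ‖v‖ ^ (1 + σ)) +
          C * ‖u - v‖ := hbd u v
      _ ≤ η / (2 * K) * K + (C + 1) * ‖u - v‖ := by
          rw [hK]
          gcongr
          linarith
      _ < η / (2 * K) * K + (C + 1) * (η / (2 * (C + 1))) := by gcongr
      _ = η := by field_simp; ring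
  · intro u
    rw [hasFDerivAt_iff_isLittleO_nhds_zero, Asymptotics.isLittleO_iff]
    intro η hη
    -- The coefficient of `‖h‖` in the growth terms once `‖h‖ ≤ 1`; the quadratic term is made small
    -- by shrinking `h`.
    set K := ‖u‖ + 1 + S * ‖u‖ ^ (1 + σ) + S with hK
    have hK0 : 0 < K := by positivity
    obtain ⟨C, hC, hpt⟩ := exists_abs_primitive_sub_le hσ hg1 hg2 (η / (2 * K)) (by positivity)
    obtain ⟨_, _, hG⟩ := exists_integral_abs_primitive_le (N := N) (s := s) hN hs hg1 hg2 1 one_pos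
    have hδ : 0 < min 1 (η / (2 * (C + 1))) := by positivity
    filter_upwards [Metric.ball_mem_nhds (0 : RadialSobolev N s) hδ] with h hh
    rw [mem_ball_zero_iff] at hh
    have hh1 : ‖h‖ ≤ 1 := (hh.trans_le (min_le_left _ _)).le
    have hh2 : ‖h‖ ≤ η / (2 * (C + 1)) := (hh.trans_le (min_le_right _ _)).le
    have i1 := integrable_abs_mul_abs (toL2 u) (toL2 h)
    have i2 := integrable_abs_mul_abs (toL2 h) (toL2 h)
    have i3 := integrable_rpow_mul_toL2 hN hs u h
    have i4 := integrable_rpow_mul_toL2 hN hs h h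
    have hint := ((hG (u + h)).1.sub (hG u).1).sub (hb u h).1
    have hpow : ‖h‖ ^ (1 + σ) ≤ 1 := Real.rpow_le_one (norm_nonneg _) hh1 (by positivity)
    rw [hD, ← integral_sub' (hG (u + h)).1 (hG u).1,
      ← integral_sub' ((hG (u + h)).1.sub (hG u).1) (hb u h).1, Real.norm_eq_abs]
    calc |∫ x, (primitive g (toL2 (u + h) x) - primitive g (toL2 u x) - g (toL2 u x) * toL2 h x)|
        ≤ ∫ x, |primitive g (toL2 (u + h) x) - primitive g (toL2 u x) - g (toL2 u x) * toL2 h x| :=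
          abs_integral_le_integral_abs
      _ ≤ ∫ x, (η / (2 * K) * (|toL2 u x| * |toL2 h x| + |toL2 h x| * |toL2 h x| +
            |toL2 u x| ^ (1 + σ) * |toL2 h x| + |toL2 h x| ^ (1 + σ) * |toL2 h x|) +
            C * (|toL2 h x| * |toL2 h x|)) := by
          refine integral_mono_ae hint.abs
            (((((i1.add i2).add i3).add i4).const_mul _).add (i2.const_mul C)) ?_
          filter_upwards [Lp.coeFn_add (toL2 u) (toL2 h)] with x hx
          rw [map_add, hx, Pi.add_apply]
          exact hpt _ _
      _ = η / (2 * K) * ((∫ x, |toL2 u x| * |toL2 h x|) + (∫ x, |toL2 h x| * |toL2 h x|) +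
            (∫ x, |toL2 u x| ^ (1 + σ) * |toL2 h x|) +
            (∫ x, |toL2 h x| ^ (1 + σ) * |toL2 h x|)) +
            C * ∫ x, |toL2 h x| * |toL2 h x| := 
          integral_linear_combination i1 i2 i3 i4 i2 _ C
      _ ≤ η / (2 * K) * (‖u‖ * ‖h‖ + ‖h‖ * ‖h‖ + S * ‖u‖ ^ (1 + σ) * ‖h‖ +
            S * ‖h‖ ^ (1 + σ) * ‖h‖) + C * (‖h‖ * ‖h‖) := by
          have := hHol2 u h
          have := hHol2 h h
          have := hHol u h
          have := hHol h h
          gcongr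
      _ ≤ η / (2 * K) * (‖u‖ * ‖h‖ + 1 * ‖h‖ + S * ‖u‖ ^ (1 + σ) * ‖h‖ +
            S * 1 * ‖h‖) + (C + 1) * (η / (2 * (C + 1)) * ‖h‖) := by
          gcongr
          linarith
      _ = η * ‖h‖ := by rw [hK]; field_simp; ring

end

/-! ### Completeness of `H^s_r` and formulas for the functionals. -/

section

variable {N : ℕ} {s : ℝ} {g : ℝ → ℝ}

namespace RadialSobolev

/-- The inclusion of `H^s_r` into `L²` as a continuous linear map. -/
def toL2CLM (N : ℕ) (s : ℝ) : RadialSobolev N s →L[ℝ] L2R N :=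
  LinearMap.mkContinuous toL2 1 fun u => by rw [one_mul]; exact norm_toL2_le u

/-- `(-Δ)^(s/2)` as a continuous linear map on `H^s_r`. -/
def fracLapCLM (N : ℕ) (s : ℝ) : RadialSobolev N s →L[ℝ] L2C N :=
  LinearMap.mkContinuous
    { toFun := fracLap, map_add' := fracLap_add, map_smul' := fracLap_smul } 1
    fun u => by rw [one_mul]; exact norm_fracLap_le u

@[simp] lemma toL2CLM_apply (u : RadialSobolev N s) : toL2CLM N s u = toL2 u := rfl

@[simp] lemma fracLapCLM_apply (u : RadialSobolev N s) : fracLapCLM N s u = fracLap u := rfl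

lemma kinetic_eq (u : RadialSobolev N s) : kinetic u = ‖fracLap u‖ ^ 2 :=
  (norm_sq_eq_integral _).symm

lemma mass_eq (u : RadialSobolev N s) : mass u = ‖toL2 u‖ ^ 2 := by
  rw [← integral_abs_sq, mass]
  simp only [sq_abs]

lemma exists_ae_subseq {E : Type*} [NormedAddCommGroup E]
    {f : ℕ → Lp E 2 (volume : Measure (Space N))}
    {F : Lp E 2 (volume : Measure (Space N))} (h : Tendsto f atTop (𝓝 F)) :
    ∃ φ : ℕ → ℕ, StrictMono φ ∧ ∀ᵐ x, Tendsto (fun n => f (φ n) x) atTop (𝓝 (F x)) :=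
  (tendstoInMeasure_of_tendsto_Lp h).exists_seq_tendsto_ae

/-- The graph of `u ↦ (u, (-Δ)^(s/2) u)` is closed: on the Fourier side the operator is a
multiplication, which passes to almost everywhere limits of subsequences, and so does radiality. -/
instance : CompleteSpace (RadialSobolev N s) := by
  refine Metric.complete_of_cauchySeq_tendsto fun u hu => ?_
  obtain ⟨v, hv⟩ := cauchySeq_tendsto_of_complete
    ((toL2CLM N s).uniformContinuous.comp_cauchySeq hu)
  obtain ⟨w, hw⟩ := cauchySeq_tendsto_of_complete
    ((fracLapCLM N s).uniformContinuous.comp_cauchySeq hu)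
  have hv : Tendsto (fun n => toL2 (u n)) atTop (𝓝 v) := hv
  have hw : Tendsto (fun n => fracLap (u n)) atTop (𝓝 w) := hw
  have hvrad : v ∈ radial N := by
    obtain ⟨φ, -, hae⟩ := exists_ae_subseq hv
    choose f hf using fun n => (u (φ n)).2.2
    -- Radii at which the profiles diverge receive a default value, harmless because the profiles
    -- converge at `‖x‖` for almost every `x`.
    refine ⟨fun r => limUnder atTop fun n => f n r, ?_⟩
    filter_upwards [hae, ae_all_iff.2 hf] with x h1 h2
    refine (Tendsto.limUnder_eq (h1.congr fun n => ?_)).symm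
    exact h2 n
  have hFu : Tendsto (fun n => fourierL2 N (toL2 (u n))) atTop (𝓝 (fourierL2 N v)) := by
    have hc : Continuous fun u : L2R N => fourierL2 N u :=
      (Lp.fourierTransformₗᵢ (Space N) ℂ).continuous.comp (complexify N).continuous
    exact (hc.tendsto v).comp hv
  have hFw : Tendsto (fun n => (memLp_fracSymbol (u n)).toLp) atTop (𝓝 (𝓕 w : L2C N)) := by
    have h1 := ((Lp.fourierTransformₗᵢ (Space N) ℂ).continuous.tendsto w).comp hw
    refine h1.congr fun n => ?_
    exact (Lp.fourierTransformₗᵢ (Space N) ℂ).apply_symm_apply _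
  have hsym : (𝓕 w : L2C N) =ᵐ[volume] fracSymbol N s v := by
    obtain ⟨φ, hφ, h1⟩ := exists_ae_subseq hFu
    obtain ⟨ψ, hψ, h2⟩ := exists_ae_subseq (hFw.comp hφ.tendsto_atTop)
    filter_upwards [h1, h2, ae_all_iff.2 fun n => (memLp_fracSymbol (u n)).coeFn_toLp]
      with ξ h1 h2 h3
    refine tendsto_nhds_unique h2 (((h1.comp hψ.tendsto_atTop).const_mul
      (((2 * Real.pi * ‖ξ‖) ^ s : ℝ) : ℂ)).congr fun n => ?_)
    exact (h3 _).symm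
  have hmem : MemLp (fracSymbol N s v) 2 volume := (memLp_congr_ae hsym).1 (Lp.memLp _)
  let a : RadialSobolev N s := ⟨v, hmem, hvrad⟩
  have ha1 : toL2 a = v := rfl
  have ha2 : fracLap a = w := by
    have : (memLp_fracSymbol a).toLp = (𝓕 w : L2C N) := by
      refine Lp.ext ?_
      exact (memLp_fracSymbol a).coeFn_toLp.trans hsym.symm
    rw [fracLap, this]
    exact (Lp.fourierTransformₗᵢ (Space N) ℂ).symm_apply_apply w
  refine ⟨a, ?_⟩
  rw [tendsto_iff_norm_sub_tendsto_zero]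
  have hsq : Tendsto (fun n => ‖u n - a‖ ^ 2) atTop (𝓝 0) := by
    have e : ∀ n, ‖u n - a‖ ^ 2 = ‖toL2 (u n) - v‖ ^ 2 + ‖fracLap (u n) - w‖ ^ 2 := fun n => by
      rw [norm_sq_eq, map_sub, ha1, ← fracLapCLM_apply, map_sub, fracLapCLM_apply,
        fracLapCLM_apply, ha2]
    simp only [e]
    have h1 := (tendsto_iff_norm_sub_tendsto_zero.1 hv).pow 2
    have h2 := (tendsto_iff_norm_sub_tendsto_zero.1 hw).pow 2
    simpa using h1.add h2
  have := hsq.sqrt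
  simpa [Real.sqrt_sq (norm_nonneg _)] using this

end RadialSobolev

open RadialSobolev

lemma lagrangian_eq (m : ℝ) (z : ℝ × RadialSobolev N s) :
    lagrangian g m z = (1 / 2) * ‖fracLapCLM N s z.2‖ ^ 2 - (∫ x, primitive g (toL2 z.2 x))
      + Real.exp z.1 / 2 * (‖toL2CLM N s z.2‖ ^ 2 - m) := by
  rw [lagrangian, kinetic_eq, mass_eq]; rfl

lemma contDiff_lagrangian (hN : 0 < N) (hs : 0 < s) (hg1 : CondG1 g) (hg2 : CondG2 N s g)
    (m : ℝ) : ContDiff ℝ 1 (lagrangian g m : ℝ × RadialSobolev N s → ℝ) := by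
  obtain ⟨D, -, hDc, hD⟩ := exists_hasFDerivAt_integral_primitive (N := N) (s := s) hN hs hg1 hg2
  have hΨ : ContDiff ℝ 1 fun v : RadialSobolev N s => ∫ x, primitive g (toL2 v x) :=
    contDiff_one_iff_hasFDerivAt.2 ⟨D, hDc, hD⟩
  have e : (lagrangian g m : ℝ × RadialSobolev N s → ℝ) = fun z =>
      (1 / 2) * ‖fracLapCLM N s z.2‖ ^ 2 - (∫ x, primitive g (toL2 z.2 x))
      + Real.exp z.1 / 2 * (‖toL2CLM N s z.2‖ ^ 2 - m) := funext (lagrangian_eq m)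
  rw [e]
  have h1 : ContDiff ℝ 1 fun z : ℝ × RadialSobolev N s => ‖fracLapCLM N s z.2‖ ^ 2 :=
    ((fracLapCLM N s).contDiff.comp contDiff_snd).norm_sq ℝ
  have h2 : ContDiff ℝ 1 fun z : ℝ × RadialSobolev N s => ‖toL2CLM N s z.2‖ ^ 2 :=
    ((toL2CLM N s).contDiff.comp contDiff_snd).norm_sq ℝ
  have h3 : ContDiff ℝ 1 fun z : ℝ × RadialSobolev N s => ∫ x, primitive g (toL2 z.2 x) :=
    hΨ.comp contDiff_snd
  have h4 : ContDiff ℝ 1 fun z : ℝ × RadialSobolev N s => Real.exp z.1 :=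
    Real.contDiff_exp.comp contDiff_fst
  exact ((contDiff_const.mul h1).sub h3).add ((h4.div_const 2).mul (h2.sub contDiff_const))

lemma partialLam_eq (m : ℝ) (z : ℝ × RadialSobolev N s) :
    partialLam g m z = Real.exp z.1 / 2 * (‖toL2 z.2‖ ^ 2 - m) := by
  rw [partialLam]
  refine HasDerivAt.deriv ?_
  simp only [lagrangian, mass_eq]
  exact (((Real.hasDerivAt_exp z.1).div_const 2).mul_const _).const_add _

lemma partialU_apply (hN : 0 < N) (hs : 0 < s) (hg1 : CondG1 g) (hg2 : CondG2 N s g)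
    (m : ℝ) (z : ℝ × RadialSobolev N s) (h : RadialSobolev N s) :
    partialU g m z h = inner ℝ (fracLap z.2) (fracLap h) - (∫ x, g (toL2 z.2 x) * toL2 h x)
      + Real.exp z.1 * inner ℝ (toL2 z.2) (toL2 h) := by
  obtain ⟨D, hDa, -, hD⟩ := exists_hasFDerivAt_integral_primitive (N := N) (s := s) hN hs hg1 hg2
  have h1 := ((fracLapCLM N s).hasFDerivAt (x := z.2)).norm_sq
  have h2 := ((toL2CLM N s).hasFDerivAt (x := z.2)).norm_sq
  have h3 := ((h1.const_mul (1 / 2)).sub (hD z.2)).add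
    ((h2.sub_const m).const_mul (Real.exp z.1 / 2))
  have e : (fun v : RadialSobolev N s => lagrangian g m (z.1, v)) = fun v =>
      (1 / 2) * ‖fracLapCLM N s v‖ ^ 2 - (∫ x, primitive g (toL2 v x))
      + Real.exp z.1 / 2 * (‖toL2CLM N s v‖ ^ 2 - m) := funext fun v => lagrangian_eq m (z.1, v)
  have h4 := congrArg (fun L => L h) (HasFDerivAt.fderiv h3)
  rw [partialU, e]
  refine h4.trans ?_
  simp [hDa]
  ring

/-- Eliminates both the nonlinearity and the mass, so that the kinetic energy and `e^λ` control each
other. -/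
lemma pohozaev_eq (hN : 0 < N) (hs : 0 < s) (hg1 : CondG1 g) (hg2 : CondG2 N s g)
    (m : ℝ) (z : ℝ × RadialSobolev N s) :
    pohozaev g z = N * lagrangian g m z - s * ‖fracLap z.2‖ ^ 2 + N * m / 2 * Real.exp z.1 := by
  obtain ⟨_, _, hG⟩ := exists_integral_abs_primitive_le (N := N) (s := s) hN hs hg1 hg2 1 one_pos
  rw [pohozaev, lagrangian, kinetic_eq, integral_sub _ (hG z.2).1, integral_const_mul]
  · change _ + N * (Real.exp z.1 / 2 * mass z.2 - _) = _
    ring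
  · simpa only [sq_abs] using (integrable_abs_sq (toL2 z.2)).const_mul (Real.exp z.1 / 2)

end

/-! ### The Palais–Smale–Pohozaev condition and the critical set. -/

section

variable {N : ℕ} {s : ℝ} {g : ℝ → ℝ}

open RadialSobolev

/-- Palais–Smale–Pohozaev sequences at a negative level are bounded. -/
lemma exists_bound_of_psp (hN : 0 < N) (hs : 0 < s) (hg1 : CondG1 g) (hg2 : CondG2 N s g)
    {m b : ℝ} (hm : 0 < m) (hb : b < 0) (z : ℕ → ℝ × RadialSobolev N s)
    (hL : Tendsto (fun n => lagrangian g m (z n)) atTop (𝓝 b))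
    (hlam : Tendsto (fun n => partialLam g m (z n)) atTop (𝓝 0))
    (hP : Tendsto (fun n => pohozaev g (z n)) atTop (𝓝 0)) :
    ∃ (n₀ : ℕ) (a c B : ℝ), ∀ n, n₀ ≤ n → (z n).1 ∈ Icc a c ∧ ‖(z n).2‖ ≤ B := by
  have hN' : (0 : ℝ) < N := by exact_mod_cast hN
  obtain ⟨C, hC, hGN⟩ := exists_integral_rpow_le (N := N) (s := s) hN hs
  set σ := 4 * s / (N : ℝ) with hσdef
  have hσ : 0 < σ := by positivity
  have hb' : 0 < -b := by linarith
  -- Lower bound for `e^λ`: eventually `(N m / 2) e^λ - s A > -N b / 2`, where `A ≥ 0` is the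
  -- kinetic energy.
  set μ₀ := -b / m with hμ₀
  have hμ₀0 : 0 < μ₀ := by positivity
  -- Mass bound, from `(e^λ / 2)(‖u‖₂² - m) < 1` and `e^λ ≥ μ₀`.
  set M₁ := m + 2 / μ₀ with hM₁
  have hM₁0 : 0 < M₁ := by positivity
  set c := C * √M₁ ^ σ with hc
  have hc0 : 0 ≤ c := by positivity
  -- With this factor the critical part of `∫ G(u)` is at most `A / 4`, half of the kinetic term in
  -- `I`; the `+ 1` avoids division by zero.
  obtain ⟨C', hC', hG⟩ := exists_integral_abs_primitive_le (N := N) (s := s) hN hs hg1 hg2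
    (1 / (4 * (c + 1))) (by positivity)
  set A₁ := 4 * (b + 2 + C' * M₁) with hA₁
  set μ₁ := (s * A₁ - N * b + 1) / (N * m / 2) with hμ₁
  have hid : Tendsto (fun n => N * m / 2 * Real.exp (z n).1 - s * ‖fracLap (z n).2‖ ^ 2) atTop
      (𝓝 (0 - N * b)) := by
    refine (hP.sub (hL.const_mul (N : ℝ))).congr fun n => ?_
    rw [pohozaev_eq hN hs hg1 hg2 m]
    ring
  have hev : ∀ᶠ n in atTop, (z n).1 ∈ Icc (Real.log μ₀) (Real.log μ₁) ∧
      ‖(z n).2‖ ≤ √(M₁ + A₁) := by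
    have h1 : 0 - N * b > -(N * b) / 2 := by nlinarith
    have h2 : 0 - N * b < -(N * b) + 1 := by linarith
    filter_upwards [hid.eventually (lt_mem_nhds h1), hid.eventually (gt_mem_nhds h2),
      hL.eventually (gt_mem_nhds (show b < b + 1 by linarith)),
      hlam.eventually (lt_mem_nhds (show (-1 : ℝ) < 0 by norm_num)),
      hlam.eventually (gt_mem_nhds (show (0 : ℝ) < 1 by norm_num))] with n e1 e2 e3 e4 e5
    rw [partialLam_eq] at e4 e5
    set μ := Real.exp (z n).1 with hμ
    set A := ‖fracLap (z n).2‖ ^ 2 with hA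
    have hA0 : 0 ≤ A := by positivity
    have hμpos : 0 < μ := Real.exp_pos _
    have hμlow : μ₀ ≤ μ := by
      rw [hμ₀, div_le_iff₀ hm]
      have : N * (-b) ≤ N * (μ * m) := by nlinarith [mul_nonneg hs.le hA0]
      exact le_of_mul_le_mul_left this hN'
    have hmass : ‖toL2 (z n).2‖ ^ 2 ≤ M₁ := by
      have h3 : ‖toL2 (z n).2‖ ^ 2 - m ≤ 2 / μ := by
        rw [le_div_iff₀ hμpos]; linarith
      have h4 : 2 / μ ≤ 2 / μ₀ := by gcongr
      rw [hM₁]; linarith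
    have hkin : A ≤ A₁ := by
      have h3 : ‖toL2 (z n).2‖ ≤ √M₁ := Real.le_sqrt_of_sq_le hmass
      have h4 : ∫ x, |toL2 (z n).2 x| ^ (2 + σ) ≤ c * A := by
        refine (hGN _).trans ?_
        rw [hc]
        gcongr
      have h5 := (hG (z n).2).2
      have h6 : 1 / (4 * (c + 1)) * ∫ x, |toL2 (z n).2 x| ^ (2 + σ) ≤ A / 4 := by
        calc _ ≤ 1 / (4 * (c + 1)) * ((c + 1) * A) := by
              gcongr; exact h4.trans (by gcongr; linarith)
          _ = A / 4 := by field_simp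
      have h7 : C' * ‖toL2 (z n).2‖ ^ 2 ≤ C' * M₁ := by gcongr
      have h8 := (abs_le.1 (h5.trans (add_le_add h7 h6))).2
      rw [lagrangian_eq, fracLapCLM_apply, toL2CLM_apply, ← hA, ← hμ] at e3
      rw [hA₁]
      linarith
    have hμup : μ ≤ μ₁ := by
      rw [hμ₁, le_div_iff₀ (by positivity)]
      have : s * A ≤ s * A₁ := by gcongr
      linarith
    refine ⟨⟨?_, ?_⟩, Real.le_sqrt_of_sq_le ?_⟩
    · rw [← Real.log_exp (z n).1]; exact Real.log_le_log hμ₀0 hμlow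
    · rw [← Real.log_exp (z n).1]; exact Real.log_le_log hμpos hμup
    · rw [norm_sq_eq]; exact add_le_add hmass hkin
  obtain ⟨n₀, hn₀⟩ := eventually_atTop.1 hev
  exact ⟨n₀, _, _, _, hn₀⟩

lemma tendsto_lqNorm (hN : 0 < N) (hs : 0 < s) {ι : Type*} {l : Filter ι}
    (d : ι → RadialSobolev N s)
    (h : Tendsto (fun i => ∫⁻ x, ENNReal.ofReal (|toL2 (d i) x| ^ (2 + 4 * s / (N : ℝ)))) l
      (𝓝 0)) :
    Tendsto (fun i => lqNorm (4 * s / (N : ℝ)) (toL2 (d i))) l (𝓝 0) := by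
  have hN' : (0 : ℝ) < N := by exact_mod_cast hN
  have h1 := (ENNReal.tendsto_toReal ENNReal.zero_ne_top).comp h
  have h2 : Tendsto (fun i => ∫ x, |toL2 (d i) x| ^ (2 + 4 * s / (N : ℝ))) l (𝓝 0) := by
    refine h1.congr fun i => ?_
    rw [Function.comp_apply, ← ofReal_integral_eq_lintegral_ofReal (integrable_rpow_toL2 hN hs _)
      (ae_of_all _ fun x => by positivity),
      ENNReal.toReal_ofReal (integral_nonneg fun _ => by positivity)]
  have hpos : 0 < 1 / (2 + 4 * s / (N : ℝ)) := by positivity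
  have h3 := h2.rpow_const (p := 1 / (2 + 4 * s / (N : ℝ))) (Or.inr hpos.le)
  rwa [Real.zero_rpow hpos.ne'] at h3

/-- A bounded Palais–Smale sequence that is Cauchy in `L^q` is Cauchy in `H^s_r`. -/
lemma cauchySeq_of_psp (hN : 0 < N) (hs : 0 < s) (hg1 : CondG1 g) (hg2 : CondG2 N s g)
    {m l₀ B : ℝ} (z : ℕ → ℝ × RadialSobolev N s)
    (hl : Tendsto (fun n => (z n).1) atTop (𝓝 l₀)) (hB : ∀ n, ‖(z n).2‖ ≤ B)
    (hU : Tendsto (fun n => ‖partialU g m (z n)‖) atTop (𝓝 0))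
    (hq : Tendsto (fun p : ℕ × ℕ => ∫⁻ x, ENNReal.ofReal
      (|toL2 ((z p.1).2 - (z p.2).2) x| ^ (2 + 4 * s / (N : ℝ)))) atTop (𝓝 0)) :
    CauchySeq fun n => (z n).2 := by
  have hN' : (0 : ℝ) < N := by exact_mod_cast hN
  have hB0 : 0 ≤ B := (norm_nonneg _).trans (hB 0)
  obtain ⟨S, hS, hemb⟩ := exists_lqNorm_le (N := N) (s := s) hN hs
  have hQ := tendsto_lqNorm hN hs (fun p : ℕ × ℕ => (z p.1).2 - (z p.2).2) hq
  set σ := 4 * s / (N : ℝ) with hσdef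
  have hσ : 0 < σ := by positivity
  -- Coercivity constant: eventually `e^λ > e^(l₀) / 2`, so the quadratic form dominates `κ ‖d‖²`.
  set κ := min 1 (Real.exp l₀ / 2) with hκ
  have hκ0 : 0 < κ := lt_min one_pos (by positivity)
  have hfst : Tendsto (fun p : ℕ × ℕ => p.1) atTop atTop := by
    rw [← prod_atTop_atTop_eq]; exact tendsto_fst
  have hsnd : Tendsto (fun p : ℕ × ℕ => p.2) atTop atTop := by
    rw [← prod_atTop_atTop_eq]; exact tendsto_snd
  have hexp : Tendsto (fun n => Real.exp (z n).1) atTop (𝓝 (Real.exp l₀)) :=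
    (Real.continuous_exp.tendsto l₀).comp hl
  rw [cauchySeq_iff_tendsto_dist_atTop_0]
  simp only [dist_eq_norm]
  have hsq : Tendsto (fun p : ℕ × ℕ => ‖(z p.1).2 - (z p.2).2‖ ^ 2) atTop (𝓝 0) := by
    rw [Metric.tendsto_nhds]
    intro η hη
    -- The two linear error terms add up to `4 ε B²`, which this choice keeps below half of `η κ`.
    set ε := η * κ / (2 * (4 * B ^ 2 + 1)) with hε
    obtain ⟨C, hC, hg⟩ := exists_abs_integral_mul_le (N := N) (s := s) hN hs hg1 hg2 ε
      (by positivity)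
    have herr : Tendsto (fun p : ℕ × ℕ =>
        (‖partialU g m (z p.1)‖ + ‖partialU g m (z p.2)‖) * (2 * B) +
        2 * (C * ((S * B) ^ (1 + σ) * lqNorm σ (toL2 ((z p.1).2 - (z p.2).2)))) +
        |Real.exp (z p.1).1 - Real.exp (z p.2).1| * (B * (2 * B))) atTop (𝓝 0) := by
      have t1 := ((hU.comp hfst).add (hU.comp hsnd)).mul_const (2 * B)
      have t2 := ((hQ.const_mul ((S * B) ^ (1 + σ))).const_mul C).const_mul 2
      have t3 := ((hexp.comp hfst).sub (hexp.comp hsnd)).abs.mul_const (B * (2 * B))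
      simpa using (t1.add t2).add t3
    have hlow : ∀ᶠ p : ℕ × ℕ in atTop, Real.exp l₀ / 2 < Real.exp (z p.1).1 :=
      (hexp.comp hfst).eventually (lt_mem_nhds (by linarith [Real.exp_pos l₀]))
    filter_upwards [herr.eventually (gt_mem_nhds (show 0 < η * κ / 2 by positivity)), hlow]
      with p e1 e2
    set u := (z p.1).2 with hu
    set v := (z p.2).2 with hv
    set d := u - v with hd
    set μ := Real.exp (z p.1).1
    set ν := Real.exp (z p.2).1
    have hdB : ‖d‖ ≤ 2 * B := (norm_sub_le _ _).trans (by linarith [hB p.1, hB p.2])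
    have hI : ∀ w : RadialSobolev N s, ‖w‖ ≤ B → |∫ x, g (toL2 w x) * toL2 d x| ≤
        ε * (B * (2 * B)) + C * ((S * B) ^ (1 + σ) * lqNorm σ (toL2 d)) := by
      intro w hw
      refine (hg w d).2.trans ?_
      have h1 := (norm_toL2_le w).trans hw
      have h2 := (norm_toL2_le d).trans hdB
      have h3 := integral_rpow_mul_le hσ (aestronglyMeasurable_toL2 w)
        (aestronglyMeasurable_toL2 d) (integrable_rpow_toL2 hN hs w)
        (integrable_rpow_toL2 hN hs d)
      have h4 : lqNorm σ (toL2 w) ≤ S * B := (hemb w).trans (by gcongr)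
      have h5 := lqNorm_nonneg σ (toL2 w)
      have h6 := lqNorm_nonneg σ (toL2 d)
      have h7 : lqNorm σ (toL2 w) ^ (1 + σ) * lqNorm σ (toL2 d) ≤
          (S * B) ^ (1 + σ) * lqNorm σ (toL2 d) := by gcongr
      have h8 := h3.trans h7
      gcongr
    have hIu := abs_le.1 (hI u (hB p.1))
    have hIv := abs_le.1 (hI v (hB p.2))
    have hinner : |inner ℝ (toL2 v) (toL2 d)| ≤ B * (2 * B) :=
      (abs_real_inner_le_norm _ _).trans (mul_le_mul ((norm_toL2_le v).trans (hB p.2))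
        ((norm_toL2_le d).trans hdB) (norm_nonneg _) hB0)
    have hUd : ∀ n, |partialU g m (z n) d| ≤ ‖partialU g m (z n)‖ * (2 * B) := fun n =>
      ((partialU g m (z n)).le_opNorm d).trans (by gcongr)
    have hLap : inner ℝ (fracLap u) (fracLap d) - inner ℝ (fracLap v) (fracLap d) =
        ‖fracLap d‖ ^ 2 := by
      rw [← inner_sub_left, ← fracLapCLM_apply, ← fracLapCLM_apply, ← fracLapCLM_apply, ← map_sub,
        ← hd, real_inner_self_eq_norm_sq]
    have hL2 : inner ℝ (toL2 u) (toL2 d) = inner ℝ (toL2 v) (toL2 d) + ‖toL2 d‖ ^ 2 := by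
      rw [← real_inner_self_eq_norm_sq, ← inner_add_left, ← map_add, hd, add_sub_cancel]
    -- The two derivatives are subtracted and tested on `d`. Using the single multiplier `μ` leaves
    -- an error proportional to `μ - ν`, which vanishes as `λ` converges.
    have hkey : ‖fracLap d‖ ^ 2 + μ * ‖toL2 d‖ ^ 2 =
        partialU g m (z p.1) d - partialU g m (z p.2) d +
        (∫ x, g (toL2 u x) * toL2 d x) - (∫ x, g (toL2 v x) * toL2 d x) -
        (μ - ν) * inner ℝ (toL2 v) (toL2 d) := by
      rw [partialU_apply hN hs hg1 hg2, partialU_apply hN hs hg1 hg2, ← hu, ← hv, ← hLap, hL2]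
      ring
    have hμν : -((μ - ν) * inner ℝ (toL2 v) (toL2 d)) ≤ |μ - ν| * (B * (2 * B)) := by
      refine (neg_le_abs _).trans ?_
      rw [abs_mul]
      gcongr
    have hcoer : κ * ‖d‖ ^ 2 ≤ ‖fracLap d‖ ^ 2 + μ * ‖toL2 d‖ ^ 2 := by
      rw [norm_sq_eq, mul_add]
      have h1 : κ ≤ μ := (min_le_right _ _).trans e2.le
      have h2 : κ ≤ 1 := min_le_left _ _
      have h3 : κ * ‖fracLap d‖ ^ 2 ≤ 1 * ‖fracLap d‖ ^ 2 := by gcongr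
      have h4 : κ * ‖toL2 d‖ ^ 2 ≤ μ * ‖toL2 d‖ ^ 2 := by gcongr
      linarith
    have hεB : 2 * (ε * (B * (2 * B))) ≤ η * κ / 2 := by
      have : ε * (4 * B ^ 2 + 1) = η * κ / 2 := by rw [hε]; field_simp
      have hε0 : 0 ≤ ε := by positivity
      nlinarith
    have hfin : κ * ‖d‖ ^ 2 < κ * η := by
      have a1 := (abs_le.1 (hUd p.1)).2
      have a2 := (abs_le.1 (hUd p.2)).1
      linarith
    rw [dist_zero_right, Real.norm_of_nonneg (by positivity)]
    exact lt_of_mul_lt_mul_left hfin hκ0.le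
  simpa [Real.sqrt_sq (norm_nonneg _)] using hsq.sqrt

theorem pspCondition_of_neg (hN : 2 ≤ N) (hs : 0 < s) (hg1 : CondG1 g) (hg2 : CondG2 N s g)
    {m b : ℝ} (hm : 0 < m) (hb : b < 0) : PSPCondition N s g m b := by
  intro z hL hlam hU hP
  have hN0 : 0 < N := by omega
  obtain ⟨n₀, a, c, B, hbd⟩ := exists_bound_of_psp hN0 hs hg1 hg2 hm hb z hL hlam hP
  -- The a priori bounds hold only from `n₀` on, hence the shift.
  obtain ⟨l₀, -, φ, hφ, hl⟩ := (isCompact_Icc (a := a) (b := c)).tendsto_subseq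
    (x := fun n => (z (n + n₀)).1) (fun n => (hbd _ (by omega)).1)
  obtain ⟨ψ, hψ, hq⟩ := exists_subseq_tendsto_lintegral hN s hs
    (fun n => (z (φ n + n₀)).2) B (fun n => (hbd _ (by omega)).2)
  have hθ : StrictMono fun n => φ (ψ n) + n₀ := fun i j hij =>
    Nat.add_lt_add_right (hφ (hψ hij)) n₀
  have hl' : Tendsto (fun n => (z (φ (ψ n) + n₀)).1) atTop (𝓝 l₀) := hl.comp hψ.tendsto_atTop
  obtain ⟨u, hu⟩ := cauchySeq_tendsto_of_complete
    (cauchySeq_of_psp hN0 hs hg1 hg2 (fun n => z (φ (ψ n) + n₀)) hl'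
      (fun n => (hbd _ (by omega)).2) (hU.comp hθ.tendsto_atTop) hq)
  exact ⟨(l₀, u), _, hθ, hl'.prodMk_nhds hu⟩

/-- Any sequence in the set satisfies the Palais–Smale–Pohozaev hypotheses trivially, and the set is
closed. -/
theorem isCompact_criticalPSP (hN : 2 ≤ N) (hs : 0 < s) (hg1 : CondG1 g) (hg2 : CondG2 N s g)
    {m b : ℝ} (hm : 0 < m) (hb : b < 0) : IsCompact (criticalPSP N s g m b) := by
  have hN0 : 0 < N := by omega
  have hI := contDiff_lagrangian (N := N) (s := s) hN0 hs hg1 hg2 m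
  have hlam : Continuous (partialLam g m : ℝ × RadialSobolev N s → ℝ) := by
    rw [funext (partialLam_eq (N := N) (s := s) m)]
    have h : Continuous fun z : ℝ × RadialSobolev N s => toL2 z.2 :=
      (toL2CLM N s).continuous.comp continuous_snd
    fun_prop
  have hP : Continuous (pohozaev g : ℝ × RadialSobolev N s → ℝ) := by
    rw [funext (pohozaev_eq (N := N) (s := s) hN0 hs hg1 hg2 m)]
    have h : Continuous fun z : ℝ × RadialSobolev N s => fracLap z.2 :=
      (fracLapCLM N s).continuous.comp continuous_snd
    have := hI.continuous
    fun_prop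
  have hU : Continuous (partialU g m : ℝ × RadialSobolev N s → RadialSobolev N s →L[ℝ] ℝ) := by
    -- The partial derivative is the total one restricted to the second factor, so its continuity
    -- follows from the `C¹` property.
    have e : (partialU g m : ℝ × RadialSobolev N s → RadialSobolev N s →L[ℝ] ℝ) = fun z =>
        (fderiv ℝ (lagrangian g m) z).comp (ContinuousLinearMap.inr ℝ ℝ (RadialSobolev N s)) := by
      funext z
      have h : HasFDerivAt (lagrangian g m) (fderiv ℝ (lagrangian g m) z) (z.1, z.2) :=
        ((hI.differentiable one_ne_zero) z).hasFDerivAt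
      exact (h.comp z.2 (hasFDerivAt_prodMk_right (𝕜 := ℝ) z.1 z.2)).fderiv
    rw [e]
    exact (hI.continuous_fderiv one_ne_zero).clm_comp continuous_const
  have hclosed : IsClosed (criticalPSP N s g m b) :=
    (isClosed_eq hI.continuous continuous_const).inter <|
      (isClosed_eq hlam continuous_const).inter <|
        (isClosed_eq hU continuous_const).inter (isClosed_eq hP continuous_const)
  refine IsSeqCompact.isCompact fun z hz => ?_
  obtain ⟨w, φ, hφ, hw⟩ := pspCondition_of_neg hN hs hg1 hg2 hm hb z
    (tendsto_const_nhds.congr fun n => (hz n).1.symm)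
    (tendsto_const_nhds.congr fun n => (hz n).2.1.symm)
    (tendsto_const_nhds.congr fun n => by rw [(hz n).2.2.1, norm_zero])
    (tendsto_const_nhds.congr fun n => (hz n).2.2.2.symm)
  exact ⟨w, hclosed.mem_of_tendsto hw (Eventually.of_forall fun n => hz (φ n)), φ, hφ, hw⟩

/-- At `u = 0` the `λ`-derivative equals `-m e^λ / 2`, which is never zero. -/
lemma mk_zero_notMem_criticalPSP {m b : ℝ} (hm : 0 < m) (l : ℝ) :
    (l, (0 : RadialSobolev N s)) ∉ criticalPSP N s g m b := by
  rintro ⟨-, h, -, -⟩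
  rw [partialLam_eq] at h
  have h0 : ‖toL2 (0 : RadialSobolev N s)‖ = 0 := by rw [map_zero, norm_zero]
  rw [h0] at h
  have := Real.exp_pos l
  have : 0 < Real.exp l / 2 * m := by positivity
  simp only at h
  linarith

end

end FracNLS

end

theorem proposition4p2 (N : ℕ) (hN : 2 ≤ N) (s : ℝ) (hs0 : 0 < s) (hs1 : s < 1)
    (m : ℝ) (hm : 0 < m) (g : ℝ → ℝ)
    (hg1 : FracNLS.CondG1 g) (hg2 : FracNLS.CondG2 N s g) (hg3 : FracNLS.CondG3 g)
    (b : ℝ) (hb : b < 0) :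
    (∀ u : FracNLS.RadialSobolev N s, MeasureTheory.Integrable
      (fun x => FracNLS.primitive g (FracNLS.RadialSobolev.toL2 u x)) MeasureTheory.volume) ∧
    ContDiff ℝ 1 (FracNLS.lagrangian g m : ℝ × FracNLS.RadialSobolev N s → ℝ) ∧
    FracNLS.PSPCondition N s g m b ∧
    IsCompact (FracNLS.criticalPSP N s g m b) ∧
    ∀ l : ℝ, (l, (0 : FracNLS.RadialSobolev N s)) ∉ FracNLS.criticalPSP N s g m b := by
  have hN0 : 0 < N := by omega
  obtain ⟨_, _, hG⟩ :=
    FracNLS.exists_integral_abs_primitive_le (N := N) (s := s) hN0 hs0 hg1 hg2 1 one_pos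
  exact ⟨fun u => (hG u).1, FracNLS.contDiff_lagrangian hN0 hs0 hg1 hg2 m,
    FracNLS.pspCondition_of_neg hN hs0 hg1 hg2 hm hb,
    FracNLS.isCompact_criticalPSP hN hs0 hg1 hg2 hm hb,
    fun l => FracNLS.mk_zero_notMem_criticalPSP hm l⟩
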